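/- Let $\mathcal S_e(\mathbb R)$ be the space of even complex-valued Schwartz functions on $\mathbb R$ with the $L^2$ inner product, let $L^2_e(\mathbb R)$ be the subspace of even functions in $L^2(\mathbb R)$, and let $H_{1/2}$ be the weighted Bergman space of holomorphic functions on the open upper half-plane $\{z=b+ia : a>0\}$ that are square integrable with respect to $a^{1/2}\,da\,db$, with inner product $\langle f,g\rangle_{1/2}=\int f\,\overline{g}\,a^{1/2}\,da\,db$. For $\psi\in\mathcal S_e(\mathbb R)$ and $\operatorname{Im} z>0$ put $$(A_e\psi)(z)=\frac{1}{\sqrt2\,\pi^{3/4}}\int_{-\infty}^{\infty}p^2e^{izp^2/2}\psi(p)\,dp .$$ The integral converges absolutely, $A_e\psi\in H_{1/2}$, and $\langle A_e\varphi,A_e\psi\rangle_{1/2}=\int_{-\infty}^\infty\varphi(p)\overline{\psi(p)}\,dp$ for all $\varphi,\psi\in\mathcal S_e(\mathbb R)$. Moreover $\mathcal S_e(\mathbb R)$ is dense in $L^2_e(\mathbb R)$, and $A_e$ extends (necessarily uniquely) to a unitary operator from $L^2_e(\mathbb R)$ onto $H_{1/2}$, again denoted $A_e$. The inverse is given by $$(A_e^{-1}f)(p)=\frac{1}{\sqrt2\,\pi^{3/4}}\lim_{\sigma,\gamma\to\infty}\int_{R_{\sigma,\gamma}}p^2e^{-i\bar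 zp^2/2}f(z)\,a^{1/2}\,da\,db,\qquad R_{\sigma,\gamma}=\{z\in\mathbb C:|\operatorname{Re}z|<\sigma,\ 1/\gamma<\operatorname{Im}z<\gamma\},$$ where $\sigma$ and $\gamma$ tend to infinity jointly and independently. For every $f\in H_{1/2}$ and all $\sigma,\gamma>0$ the integrals over $R_{\sigma,\gamma}$ converge absolutely for every $p$ and define a function of $p$ in $L^2(\mathbb R)$, and the limit holds in $L^2(\mathbb R)$. If $f=A_e\psi$ with $\psi\in\mathcal S_e(\mathbb R)$, the limit also holds pointwise: it equals $\psi(p)$ for every real $p\neq0$. -/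

import Mathlib

open MeasureTheory Filter Topology Complex
open scoped SchwartzMap ComplexConjugate ENNReal

noncomputable section

/-- The even, complex-valued Schwartz functions on the real line. -/
def evenSchwartz : Submodule ℂ 𝓢(ℝ, ℂ) where
  carrier := {ψ | ∀ p : ℝ, ψ (-p) = ψ p}
  add_mem' := by
    intro φ ψ hφ hψ p
    simp only [Set.mem_setOf_eq] at hφ hψ
    simp [hφ p, hψ p]
  zero_mem' := by
    intro p
    simp
  smul_mem' := by
    intro c ψ hψ p
    simp only [Set.mem_setOf_eq] at hψ
    simp [hψ p]

/-- The even elements of `L²(ℝ)`. -/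
def evenL2 : Submodule ℂ (Lp ℂ 2 (volume : Measure ℝ)) where
  carrier := {ψ | (fun p : ℝ => ψ (-p)) =ᵐ[volume] (fun p : ℝ => ψ p)}
  add_mem' := by
    intro φ ψ hφ hψ
    have h := Lp.coeFn_add φ ψ
    have h' := (Measure.measurePreserving_neg (volume : Measure ℝ)).quasiMeasurePreserving.ae h
    simp only [Set.mem_setOf_eq] at hφ hψ ⊢
    filter_upwards [h, h', hφ, hψ] with p h1 h2 h3 h4
    simp only [h1, h2, Pi.add_apply, h3, h4]
  zero_mem' := by
    have h := Lp.coeFn_zero ℂ 2 (volume : Measure ℝ)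
    have h' := (Measure.measurePreserving_neg (volume : Measure ℝ)).quasiMeasurePreserving.ae h
    simp only [Set.mem_setOf_eq]
    filter_upwards [h, h'] with p h1 h2
    simp only [h1, h2, Pi.zero_apply]
  smul_mem' := by
    intro c ψ hψ
    have h := Lp.coeFn_smul c ψ
    have h' := (Measure.measurePreserving_neg (volume : Measure ℝ)).quasiMeasurePreserving.ae h
    simp only [Set.mem_setOf_eq] at hψ ⊢
    filter_upwards [h, h', hψ] with p h1 h2 h3
    simp only [h1, h2, Pi.smul_apply, h3]

/-- An even Schwartz function, viewed as an even element of `L²(ℝ)`. -/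
def evenSchwartzToL2 (ψ : evenSchwartz) : evenL2 :=
  ⟨(ψ : 𝓢(ℝ, ℂ)).toLp 2 volume, by
    have h := (ψ : 𝓢(ℝ, ℂ)).coeFn_toLp 2 (volume : Measure ℝ)
    have h' := (Measure.measurePreserving_neg (volume : Measure ℝ)).quasiMeasurePreserving.ae h
    change _ =ᵐ[volume] _
    filter_upwards [h, h'] with p h1 h2
    simp only [h1, h2]
    exact ψ.2 p⟩

/-- The open upper half-plane, as a subset of `ℂ`. -/
def upperHalf : Set ℂ := {z : ℂ | 0 < z.im}

/-- The measure `a ^ (1/2) da db` on the open upper half-plane, where `z = b + i a`. -/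
def muHalf : Measure ℂ :=
  (volume.restrict upperHalf).withDensity (fun z : ℂ => ENNReal.ofReal (z.im ^ (1 / 2 : ℝ)))

/-- The weighted Bergman space: the elements of `L²(a ^ (1/2) da db)` that are (represented by)
holomorphic functions on the open upper half-plane, with the inner product of `L²`. -/
def bergmanHalf : Submodule ℂ (Lp ℂ 2 muHalf) where
  carrier := {F | ∃ f : ℂ → ℂ, DifferentiableOn ℂ f upperHalf ∧ F =ᵐ[muHalf] f}
  add_mem' := by
    rintro F G ⟨f, hf, hFf⟩ ⟨g, hg, hGg⟩
    exact ⟨f + g, hf.add hg, (Lp.coeFn_add F G).trans (hFf.add hGg)⟩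
  zero_mem' := ⟨0, differentiableOn_const 0, Lp.coeFn_zero ℂ 2 muHalf⟩
  smul_mem' := by
    rintro c F ⟨f, hf, hFf⟩
    exact ⟨c • f, hf.const_smul c, (Lp.coeFn_smul c F).trans (hFf.const_smul c)⟩

/-- The constant `1 / (√2 π^{3/4})`. -/
def cE : ℝ := 1 / (√2 * Real.pi ^ (3 / 4 : ℝ))

/-- The integrand `p² e^{i z p² / 2} ψ(p)` of the transform. -/
def kernelE (ψ : ℝ → ℂ) (z : ℂ) (p : ℝ) : ℂ :=
  (p : ℂ) ^ 2 * Complex.exp (I * z * (p : ℂ) ^ 2 / 2) * ψ p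

/-- The transform `(A_e ψ)(z) = (1 / (√2 π^{3/4})) ∫ p² e^{i z p² / 2} ψ(p) dp`. -/
def transformE (ψ : ℝ → ℂ) (z : ℂ) : ℂ := (cE : ℂ) * ∫ p : ℝ, kernelE ψ z p

/-- The rectangle `|Re z| < σ`, `1 / γ < Im z < γ`. -/
def rectE (σ γ : ℝ) : Set ℂ := {z : ℂ | |z.re| < σ ∧ 1 / γ < z.im ∧ z.im < γ}

/-- The integrand `p² e^{-i z̄ p² / 2} f(z) a ^ (1/2)` of the inverse transform. -/
def invKernelE (f : ℂ → ℂ) (p : ℝ) (z : ℂ) : ℂ :=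
  (p : ℂ) ^ 2 * Complex.exp (-(I * conj z * (p : ℂ) ^ 2 / 2)) * f z * ((z.im ^ (1 / 2 : ℝ) : ℝ) : ℂ)

/-- The inverse transform truncated to the rectangle `rectE σ γ`; the integral is with respect to
the Lebesgue measure `da db` on `ℂ`. -/
def invTruncE (σ γ : ℝ) (f : ℂ → ℂ) (p : ℝ) : ℂ :=
  (cE : ℂ) * ∫ z in rectE σ γ, invKernelE f p z

end

noncomputable section

/-! The transform is a coefficient map: `(A_e ψ)(w) = ⟨g_w, ψ⟩` with `g_w(p) = c p² exp(-i w̄ p²/2)`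
in even L². The Bergman space has a reproducing kernel, `f(w) = ⟨k_w, f⟩`, found by carrying the
mean value property of the disc through the Cayley transform. A fourth Gaussian moment gives `⟨g_z,
g_w⟩ = (3/(8π)) (2i/(z - w̄))^(5/2) = ⟨k_z, k_w⟩`. Both families are total: a function orthogonal to
all `k_w` vanishes pointwise, and an even one orthogonal to all `g_w` vanishes by Fourier uniqueness
in `t = p²`. Total families with the same Gram matrix are related by a unitary `U` with `U g_w =
k_w`, and `(Uψ)(w) = ⟨k_w, Uψ⟩ = ⟨g_w, ψ⟩`. Thus holomorphy, square integrability, isometry and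
surjectivity all come from `exists_linearIsometryEquiv_of_inner_eq`.

By Fubini the truncated inverse is `U*` applied to `F` cut off to the rectangle, so its L² error is
at most the norm of `F` off the rectangle (`enorm_invTruncLp_sub_le`).

For Schwartz `ψ`, the amplitude `p²ψ(p)` vanishes at 0, so the transform decays like `|z|^(-3/2)`
(`exists_norm_transformE_sq_mul_le`). For `p ≠ 0` the full inversion integral then converges
absolutely and is continuous in `p`. It equals `ψ` almost everywhere by the L² limit, hence at every
`p ≠ 0`. -/

/-! ### Weighted mean value property on the unit disc -/

theorem integral_mul_sqrt_one_sub_sq :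
    ∫ r in (0 : ℝ)..1, r * √(1 - r ^ 2) = 1 / 3 := by
  have hc : ContinuousOn (fun r : ℝ => -(1 / 3) * (√(1 - r ^ 2)) ^ 3) (Set.Icc 0 1) := by
    fun_prop
  have hd : ∀ r ∈ Set.Ioo (0 : ℝ) 1,
      HasDerivAt (fun r : ℝ => -(1 / 3) * (√(1 - r ^ 2)) ^ 3) (r * √(1 - r ^ 2)) r := by
    intro r hr
    have hpos : 0 < 1 - r ^ 2 := by nlinarith [hr.1, hr.2]
    have h1 : HasDerivAt (fun r : ℝ => 1 - r ^ 2) (-(2 * r)) r := by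
      simpa using (hasDerivAt_pow 2 r).const_sub 1
    have h2 := ((h1.sqrt hpos.ne').pow 3).const_mul (-(1 / 3) : ℝ)
    have hs : √(1 - r ^ 2) ≠ 0 := (Real.sqrt_pos.mpr hpos).ne'
    refine h2.congr_deriv ?_
    push_cast
    field_simp
  rw [intervalIntegral.integral_eq_sub_of_hasDerivAt_of_le zero_le_one hc hd]
  · norm_num
  · exact (by fun_prop : Continuous fun r : ℝ => r * √(1 - r ^ 2)).intervalIntegrable _ _

theorem integral_circle_of_differentiableOn_ball {h : ℂ → ℂ}
    (hh : DifferentiableOn ℂ h (Metric.ball 0 1)) {r : ℝ} (hr : r ∈ Set.Ioo (0 : ℝ) 1) :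
    ∫ θ in Set.Ioo (-Real.pi) Real.pi, h (Complex.polarCoord.symm (r, θ)) =
      2 * Real.pi * h 0 := by
  have hdc : DiffContOnCl ℂ h (Metric.ball 0 |r|) := by
    apply (hh.mono ?_).diffContOnCl
    rw [closure_ball _ (abs_pos.mpr hr.1.ne').ne']
    exact Metric.closedBall_subset_ball (by rw [abs_of_pos hr.1]; exact hr.2)
  have havg := hdc.circleAverage
  rw [Real.circleAverage_def] at havg
  have hper : Function.Periodic (fun θ => h (circleMap 0 r θ)) (2 * Real.pi) := by
    intro θ
    simp only [periodic_circleMap 0 r θ]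
  have hshift := hper.intervalIntegral_add_eq (-Real.pi) 0
  have e1 : -Real.pi + 2 * Real.pi = Real.pi := by ring
  rw [e1, zero_add] at hshift
  have e2 : ∀ θ, Complex.polarCoord.symm (r, θ) = circleMap 0 r θ := by
    intro θ
    rw [Complex.polarCoord_symm_apply, circleMap, Complex.exp_mul_I]
    push_cast
    ring
  simp_rw [e2]
  rw [← integral_Ioc_eq_integral_Ioo,
    ← intervalIntegral.integral_of_le (by linarith [Real.pi_pos]), hshift, ← havg]
  rw [Complex.real_smul]
  have : (Real.pi : ℂ) ≠ 0 := by exact_mod_cast Real.pi_ne_zero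
  push_cast
  field_simp

/-- The mean value property of holomorphic functions, for the weight `(1 - |ζ|²) ^ (1/2)` on the
unit disc. -/
theorem integral_ball_sqrt_weight {h : ℂ → ℂ}
    (hh : DifferentiableOn ℂ h (Metric.ball 0 1))
    (hi : IntegrableOn (fun ζ : ℂ => √(1 - ‖ζ‖ ^ 2) • h ζ) (Metric.ball 0 1)) :
    ∫ ζ in Metric.ball (0 : ℂ) 1, √(1 - ‖ζ‖ ^ 2) • h ζ = (2 * Real.pi / 3) * h 0 := by
  set g : ℂ → ℂ := fun ζ => √(1 - ‖ζ‖ ^ 2) • h ζ with hg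
  set S : Set (ℝ × ℝ) := Set.Ioo 0 1 ×ˢ Set.Ioo (-Real.pi) Real.pi with hS
  have hSm : MeasurableSet S := measurableSet_Ioo.prod measurableSet_Ioo
  have hST : S ⊆ polarCoord.target := by
    rintro ⟨r, θ⟩ ⟨h1, h2⟩
    exact ⟨h1.1, h2⟩
  have hmem : ∀ q ∈ S, Complex.polarCoord.symm q ∈ Metric.ball (0 : ℂ) 1 := by
    rintro ⟨r, θ⟩ ⟨h1, h2⟩
    rw [mem_ball_zero_iff, Complex.norm_polarCoord_symm, abs_of_pos h1.1]
    exact h1.2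
  have hnot : ∀ q ∈ polarCoord.target \ S, Complex.polarCoord.symm q ∉ Metric.ball (0 : ℂ) 1 := by
    rintro ⟨r, θ⟩ ⟨⟨h1, h2⟩, h3⟩ h4
    rw [mem_ball_zero_iff, Complex.norm_polarCoord_symm, abs_of_pos h1] at h4
    exact h3 ⟨⟨h1, h4⟩, h2⟩
  have hcont : ContinuousOn (fun q : ℝ × ℝ => q.1 • g (Complex.polarCoord.symm q)) S := by
    apply continuous_fst.continuousOn.smul
    have hgc : ContinuousOn g (Metric.ball 0 1) :=
      (by fun_prop : Continuous fun ζ : ℂ => √(1 - ‖ζ‖ ^ 2)).continuousOn.smul hh.continuousOn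
    have hpc : Continuous (fun q : ℝ × ℝ => Complex.polarCoord.symm q) := by
      simp only [Complex.polarCoord_symm_apply]
      fun_prop
    exact hgc.comp hpc.continuousOn hmem
  -- Fubini needs integrability in polar coordinates; it is transferred from `hi` by changing
  -- variables in the nonnegative integral of the norm.
  have hint : IntegrableOn (fun q : ℝ × ℝ => q.1 • g (Complex.polarCoord.symm q)) S
      (volume : Measure (ℝ × ℝ)) := by
    refine ⟨hcont.aestronglyMeasurable hSm, ?_⟩
    have h1 := hi.2
    rw [hasFiniteIntegral_iff_enorm] at h1 ⊢
    refine lt_of_le_of_lt ?_ h1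
    rw [← lintegral_indicator measurableSet_ball, ← Complex.lintegral_comp_polarCoord_symm]
    refine le_trans ?_ (lintegral_mono_set hST)
    refine setLIntegral_mono' hSm fun q hq => ?_
    rw [Set.indicator_of_mem (hmem q hq), enorm_smul, smul_eq_mul, Real.enorm_eq_ofReal_abs,
      abs_of_pos hq.1.1]
  rw [← integral_indicator measurableSet_ball, ← Complex.integral_comp_polarCoord_symm]
  rw [setIntegral_eq_of_subset_of_forall_sdiff_eq_zero polarCoord.open_target.measurableSet hST
    (fun q hq => by rw [Set.indicator_of_notMem (hnot q hq), smul_zero])]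
  rw [setIntegral_congr_fun hSm (g := fun q : ℝ × ℝ => q.1 • g (Complex.polarCoord.symm q))
    (fun q hq => by simp only [Set.indicator_of_mem (hmem q hq), hg])]
  rw [Measure.volume_eq_prod] at hint ⊢
  rw [setIntegral_prod _ hint]
  have hin : ∀ r ∈ Set.Ioo (0 : ℝ) 1,
      ∫ θ in Set.Ioo (-Real.pi) Real.pi, r • g (Complex.polarCoord.symm (r, θ)) =
        ((r * √(1 - r ^ 2) : ℝ) : ℂ) * (2 * Real.pi * h 0) := by
    intro r hr
    rw [← integral_circle_of_differentiableOn_ball hh hr, ← integral_const_mul]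
    congr 1
    ext θ
    simp only [hg, Complex.norm_polarCoord_symm, abs_of_pos hr.1, Complex.real_smul]
    push_cast
    ring
  rw [setIntegral_congr_fun measurableSet_Ioo hin, integral_mul_const, integral_complex_ofReal,
    ← integral_Ioc_eq_integral_Ioo, ← intervalIntegral.integral_of_le zero_le_one,
    integral_mul_sqrt_one_sub_sq]
  push_cast
  ring

/-! ### The weighted measure and the Cayley transform -/

theorem isOpen_upperHalf : IsOpen upperHalf := isOpen_lt continuous_const continuous_im

theorem measurableSet_upperHalf : MeasurableSet upperHalf := isOpen_upperHalf.measurableSet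

theorem muHalf_absolutelyContinuous : muHalf ≪ volume.restrict upperHalf :=
  withDensity_absolutelyContinuous _ _

theorem ae_mem_upperHalf : ∀ᵐ z ∂muHalf, z ∈ upperHalf :=
  muHalf_absolutelyContinuous.ae_le (ae_restrict_mem measurableSet_upperHalf)

theorem muHalf_eq : muHalf = (volume.restrict upperHalf).withDensity
    (fun z : ℂ => ((√z.im).toNNReal : ℝ≥0∞)) := by
  unfold muHalf
  simp_rw [← Real.sqrt_eq_rpow]
  rfl

theorem measurable_toNNReal_sqrt_im : Measurable fun z : ℂ => (√z.im).toNNReal :=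
  Complex.measurable_im.sqrt.real_toNNReal

theorem integrable_muHalf_iff {E : Type*} [NormedAddCommGroup E] [NormedSpace ℝ E] {g : ℂ → E} :
    Integrable g muHalf ↔ IntegrableOn (fun z => √z.im • g z) upperHalf := by
  rw [muHalf_eq, integrable_withDensity_iff_integrable_smul measurable_toNNReal_sqrt_im]
  simp only [NNReal.smul_def, Real.coe_toNNReal _ (Real.sqrt_nonneg _)]
  rfl

theorem integral_muHalf {E : Type*} [NormedAddCommGroup E] [NormedSpace ℝ E] (g : ℂ → E) :
    ∫ z, g z ∂muHalf = ∫ z in upperHalf, √z.im • g z := by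
  rw [muHalf_eq, integral_withDensity_eq_integral_smul measurable_toNNReal_sqrt_im]
  simp only [NNReal.smul_def, Real.coe_toNNReal _ (Real.sqrt_nonneg _)]

/-- The Cayley transform of the unit disc onto the upper half-plane which sends `0` to `w`. -/
def cayley (w ζ : ℂ) : ℂ := (w - conj w * ζ) / (1 - ζ)

theorem one_sub_ne_zero_of_mem_ball {ζ : ℂ} (hζ : ζ ∈ Metric.ball (0 : ℂ) 1) : 1 - ζ ≠ 0 := by
  intro h
  rw [mem_ball_zero_iff, ← sub_eq_zero.mp h] at hζ
  simp at hζ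

theorem sub_conj_ne_zero {z w : ℂ} (hz : 0 < z.im) (hw : 0 < w.im) : z - conj w ≠ 0 := by
  intro h
  have := congrArg Complex.im h
  simp at this
  linarith

theorem cayley_sub_conj (w : ℂ) {ζ : ℂ} (hζ : ζ ∈ Metric.ball (0 : ℂ) 1) :
    cayley w ζ - conj w = (w - conj w) / (1 - ζ) := by
  have := one_sub_ne_zero_of_mem_ball hζ
  rw [cayley]
  field_simp
  ring

theorem cayley_im (w : ℂ) {ζ : ℂ} (hζ : ζ ∈ Metric.ball (0 : ℂ) 1) :
    (cayley w ζ).im = w.im * (1 - ‖ζ‖ ^ 2) / ‖1 - ζ‖ ^ 2 := by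
  have h0 := one_sub_ne_zero_of_mem_ball hζ
  have h1 : ‖1 - ζ‖ ^ 2 ≠ 0 := by positivity
  rw [cayley, Complex.div_im, ← Complex.normSq_eq_norm_sq, ← Complex.normSq_eq_norm_sq] at *
  simp only [Complex.normSq_apply] at *
  simp at *
  field_simp
  ring

theorem one_sub_sq_norm_pos {ζ : ℂ} (hζ : ζ ∈ Metric.ball (0 : ℂ) 1) : 0 < 1 - ‖ζ‖ ^ 2 := by
  rw [mem_ball_zero_iff] at hζ
  nlinarith [norm_nonneg ζ]

theorem cayley_mem {w ζ : ℂ} (hw : 0 < w.im) (hζ : ζ ∈ Metric.ball (0 : ℂ) 1) :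
    cayley w ζ ∈ upperHalf := by
  have h0 := one_sub_ne_zero_of_mem_ball hζ
  have h2 := one_sub_sq_norm_pos hζ
  change 0 < (cayley w ζ).im
  rw [cayley_im w hζ]
  positivity

theorem cayley_injOn {w : ℂ} (hw : 0 < w.im) : Set.InjOn (cayley w) (Metric.ball 0 1) := by
  intro x hx y hy hxy
  have hx0 := one_sub_ne_zero_of_mem_ball hx
  have hy0 := one_sub_ne_zero_of_mem_ball hy
  have h1 := cayley_sub_conj w hx
  rw [hxy, cayley_sub_conj w hy] at h1
  have hne := sub_conj_ne_zero hw hw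
  rw [div_eq_div_iff hy0 hx0] at h1
  have := mul_left_cancel₀ hne h1
  linear_combination -this

theorem cayley_image {w : ℂ} (hw : 0 < w.im) : cayley w '' Metric.ball 0 1 = upperHalf := by
  apply Set.Subset.antisymm
  · rintro _ ⟨ζ, hζ, rfl⟩
    exact cayley_mem hw hζ
  · intro z hz
    have hz' : 0 < z.im := hz
    have hne := sub_conj_ne_zero hz hw
    have hww := sub_conj_ne_zero hw hw
    refine ⟨(z - w) / (z - conj w), ?_, ?_⟩
    · rw [mem_ball_zero_iff, norm_div, div_lt_one (norm_pos_iff.mpr hne)]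
      rw [Complex.norm_def, Complex.norm_def]
      apply Real.sqrt_lt_sqrt (Complex.normSq_nonneg _)
      simp only [Complex.normSq_apply]
      simp
      nlinarith
    · have h1 : 1 - (z - w) / (z - conj w) = (w - conj w) / (z - conj w) := by
        field_simp
        ring
      rw [cayley, h1]
      field_simp
      ring

theorem hasDerivAt_cayley (w : ℂ) {ζ : ℂ} (hζ : ζ ∈ Metric.ball (0 : ℂ) 1) :
    HasDerivAt (cayley w) ((w - conj w) / (1 - ζ) ^ 2) ζ := by
  have h0 := one_sub_ne_zero_of_mem_ball hζ
  have h1 : HasDerivAt (fun ζ : ℂ => w - conj w * ζ) (-conj w) ζ := by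
    simpa using ((hasDerivAt_id ζ).const_mul (conj w)).const_sub w
  have h2 : HasDerivAt (fun ζ : ℂ => 1 - ζ) (-1) ζ := by
    simpa using (hasDerivAt_id ζ).const_sub 1
  refine (h1.div h2 h0).congr_deriv ?_
  field_simp
  ring

/-- The real determinant of a complex-linear map is the field norm from `ℂ` to `ℝ` of its complex
determinant. -/
theorem abs_det_restrictScalars_toSpanSingleton (c : ℂ) :
    |((ContinuousLinearMap.toSpanSingleton ℂ c).restrictScalars ℝ : ℂ →L[ℝ] ℂ).det| = ‖c‖ ^ 2 := by
  change |LinearMap.det ((LinearMap.toSpanSingleton ℂ ℂ c).restrictScalars ℝ)| = _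
  rw [LinearMap.det_restrictScalars]
  simp [Algebra.norm_complex_eq, Complex.normSq_eq_norm_sq]

theorem integrableOn_upperHalf_iff_cayley {E : Type*} [NormedAddCommGroup E] [NormedSpace ℝ E]
    {w : ℂ} (hw : 0 < w.im) (g : ℂ → E) :
    IntegrableOn g upperHalf ↔ IntegrableOn
      (fun ζ => ‖(w - conj w) / (1 - ζ) ^ 2‖ ^ 2 • g (cayley w ζ)) (Metric.ball 0 1) := by
  rw [← cayley_image hw, integrableOn_image_iff_integrableOn_abs_det_fderiv_smul volume
    measurableSet_ball
    (fun ζ hζ => ((hasDerivAt_cayley w hζ).hasFDerivAt.restrictScalars ℝ).hasFDerivWithinAt)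
    (cayley_injOn hw)]
  simp_rw [abs_det_restrictScalars_toSpanSingleton]

theorem integral_upperHalf_eq_cayley {E : Type*} [NormedAddCommGroup E] [NormedSpace ℝ E]
    {w : ℂ} (hw : 0 < w.im) (g : ℂ → E) :
    ∫ z in upperHalf, g z =
      ∫ ζ in Metric.ball 0 1, ‖(w - conj w) / (1 - ζ) ^ 2‖ ^ 2 • g (cayley w ζ) := by
  rw [← cayley_image hw, integral_image_eq_integral_abs_det_fderiv_smul volume
    measurableSet_ball
    (fun ζ hζ => ((hasDerivAt_cayley w hζ).hasFDerivAt.restrictScalars ℝ).hasFDerivWithinAt)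
    (cayley_injOn hw)]
  simp_rw [abs_det_restrictScalars_toSpanSingleton]

/-! ### The reproducing kernel -/

/-- The principal branch of `q ^ (5/2)`. -/
def powFiveHalves (q : ℂ) : ℂ := q ^ 2 * q ^ (1 / 2 : ℂ)

theorem cpow_half_sq (q : ℂ) : (q ^ (1 / 2 : ℂ)) ^ 2 = q := by
  rw [← Complex.cpow_ofNat_mul]
  simp

theorem norm_powFiveHalves_sq (q : ℂ) : ‖powFiveHalves q‖ ^ 2 = ‖q‖ ^ 5 := by
  have h : ‖q ^ (1 / 2 : ℂ)‖ ^ 2 = ‖q‖ := by rw [← norm_pow, cpow_half_sq]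
  rw [powFiveHalves, norm_mul, mul_pow, h, norm_pow]
  ring

theorem powFiveHalves_ne_zero {q : ℂ} (hq : q ≠ 0) : powFiveHalves q ≠ 0 :=
  mul_ne_zero (pow_ne_zero 2 hq) (by simp [Complex.cpow_eq_zero_iff, hq])

theorem powFiveHalves_ofReal_sq {s : ℝ} (hs : 0 < s) : powFiveHalves ((s ^ 2 : ℝ) : ℂ) = s ^ 5 := by
  have h : (((s ^ 2 : ℝ) : ℂ)) ^ (1 / 2 : ℂ) = s := by
    have h1 : ((1 / 2 : ℂ)) = ((1 / 2 : ℝ) : ℂ) := by norm_num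
    rw [h1, ← Complex.ofReal_cpow (by positivity), ← Real.sqrt_eq_rpow, Real.sqrt_sq hs.le]
  rw [powFiveHalves, h]
  push_cast
  ring

theorem differentiableAt_powFiveHalves {q : ℂ} (hq : q ∈ slitPlane) :
    DifferentiableAt ℂ powFiveHalves q :=
  (differentiableAt_id.pow 2).mul (differentiableAt_id.cpow_const hq)

/-- The reproducing kernel `(3 / (8π)) (2i / (z - w̄)) ^ (5/2)` of the Bergman space. -/
def bergmanKernel (w z : ℂ) : ℂ :=
  (3 / (8 * Real.pi) : ℝ) * powFiveHalves (2 * I / (z - conj w))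

theorem two_I_div_re_pos {z w : ℂ} (hz : 0 < z.im) (hw : 0 < w.im) :
    0 < (2 * I / (z - conj w)).re := by
  have h := sub_conj_ne_zero hz hw
  have h1 : 0 < Complex.normSq (z - conj w) := Complex.normSq_pos.mpr h
  rw [Complex.div_re]
  simp
  positivity

theorem differentiableOn_bergmanKernel {w : ℂ} (hw : 0 < w.im) :
    DifferentiableOn ℂ (bergmanKernel w) upperHalf := by
  intro z hz
  have hs : 2 * I / (z - conj w) ∈ slitPlane := Or.inl (two_I_div_re_pos hz hw)
  have h1 : DifferentiableAt ℂ (fun z => 2 * I / (z - conj w)) z :=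
    (differentiableAt_const _).div (differentiableAt_id.sub_const _) (sub_conj_ne_zero hz hw)
  exact (((differentiableAt_powFiveHalves hs).comp z h1).const_mul _).differentiableWithinAt

theorem two_I_div_cayley {w ζ : ℂ} (hw : 0 < w.im) (hζ : ζ ∈ Metric.ball (0 : ℂ) 1) :
    2 * I / (cayley w ζ - conj w) = (1 - ζ) / w.im := by
  have h0 := one_sub_ne_zero_of_mem_ball hζ
  have h1 : (w.im : ℂ) ≠ 0 := by exact_mod_cast hw.ne'
  rw [cayley_sub_conj w hζ, Complex.sub_conj]
  push_cast
  field_simp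

theorem sqrt_weight_cayley {w ζ : ℂ} (hw : 0 < w.im) (hζ : ζ ∈ Metric.ball (0 : ℂ) 1) :
    ‖(w - conj w) / (1 - ζ) ^ 2‖ ^ 2 * √(cayley w ζ).im =
      4 * (√w.im) ^ 5 * √(1 - ‖ζ‖ ^ 2) / ‖1 - ζ‖ ^ 5 := by
  have h0 : ‖1 - ζ‖ ≠ 0 := norm_ne_zero_iff.mpr (one_sub_ne_zero_of_mem_ball hζ)
  have h3 : w.im = √w.im ^ 2 := (Real.sq_sqrt hw.le).symm
  rw [cayley_im w hζ, Real.sqrt_div' _ (by positivity), Real.sqrt_sq (norm_nonneg _),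
    Real.sqrt_mul hw.le, Complex.sub_conj, norm_div, norm_mul, norm_pow, Complex.norm_I,
    Complex.norm_real, Real.norm_of_nonneg (by positivity)]
  field_simp
  rw [show w.im ^ 2 = √w.im ^ 4 by rw [h3]; simp; ring]
  ring

/-- With `q = (1 - ζ)/Im w`, the conjugate of `q^(5/2)` is `|q|⁵ / q^(5/2)`, and its `|1 - ζ|⁵`
cancels the denominator of the transported weight. What remains is the disc weight times a factor
holomorphic in `ζ`, ready for the mean value property. This cancellation dictates the exponent 5/2.
-/
theorem weight_smul_kernel_cayley {w ζ : ℂ} (hw : 0 < w.im) (hζ : ζ ∈ Metric.ball (0 : ℂ) 1)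
    (c : ℂ) :
    ‖(w - conj w) / (1 - ζ) ^ 2‖ ^ 2 •
        √(cayley w ζ).im • (conj (bergmanKernel w (cayley w ζ)) * c) =
      √(1 - ‖ζ‖ ^ 2) • ((3 / (2 * Real.pi) / (√w.im) ^ 5 : ℝ) *
        (powFiveHalves ((1 - ζ) / w.im))⁻¹ * c) := by
  have h0 := one_sub_ne_zero_of_mem_ball hζ
  have h1 : (w.im : ℂ) ≠ 0 := by exact_mod_cast hw.ne'
  have hs : (√w.im : ℂ) ≠ 0 := by exact_mod_cast (Real.sqrt_pos.mpr hw).ne'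
  have hn : (‖1 - ζ‖ : ℂ) ≠ 0 := by exact_mod_cast norm_ne_zero_iff.mpr h0
  have hq : powFiveHalves ((1 - ζ) / w.im) ≠ 0 := powFiveHalves_ne_zero (div_ne_zero h0 h1)
  have hpi : (Real.pi : ℂ) ≠ 0 := by exact_mod_cast Real.pi_ne_zero
  have hnq : powFiveHalves ((1 - ζ) / w.im) * conj (powFiveHalves ((1 - ζ) / w.im)) =
      (‖1 - ζ‖ : ℂ) ^ 5 / (√w.im : ℂ) ^ 10 := by
    rw [Complex.mul_conj, Complex.normSq_eq_norm_sq, norm_powFiveHalves_sq, norm_div,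
      Complex.norm_real, Real.norm_of_nonneg hw.le, div_pow]
    rw [show w.im ^ 5 = √w.im ^ 10 by
      conv_lhs => rw [← Real.sq_sqrt hw.le]
      ring]
    push_cast
    rfl
  rw [smul_smul, sqrt_weight_cayley hw hζ, bergmanKernel, two_I_div_cayley hw hζ]
  simp only [Complex.real_smul, map_mul, Complex.conj_ofReal]
  have hnq' : conj (powFiveHalves ((1 - ζ) / w.im)) = (‖1 - ζ‖ : ℂ) ^ 5 / (√w.im : ℂ) ^ 10 *
      (powFiveHalves ((1 - ζ) / w.im))⁻¹ := by
    rw [← hnq]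
    field_simp
  rw [hnq']
  push_cast
  field_simp
  ring

/-- The reproducing property. -/
theorem integral_conj_bergmanKernel_mul {w : ℂ} (hw : 0 < w.im) {f : ℂ → ℂ}
    (hf : DifferentiableOn ℂ f upperHalf)
    (hi : Integrable (fun z => conj (bergmanKernel w z) * f z) muHalf) :
    ∫ z, conj (bergmanKernel w z) * f z ∂muHalf = f w := by
  rw [integrable_muHalf_iff, integrableOn_upperHalf_iff_cayley hw] at hi
  rw [integral_muHalf, integral_upperHalf_eq_cayley hw]
  have hcongr : ∀ ζ ∈ Metric.ball (0 : ℂ) 1, _ = _ :=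
    fun ζ hζ => weight_smul_kernel_cayley hw hζ (f (cayley w ζ))
  rw [setIntegral_congr_fun measurableSet_ball hcongr]
  rw [integrableOn_congr_fun hcongr measurableSet_ball] at hi
  -- The disc centre corresponds to `w`. The mean value constant `2π/3` cancels `4 · 3/(8π) =
  -- 3/(2π)`, which explains the normalization of the kernel.
  rw [integral_ball_sqrt_weight ?_ hi]
  · have hs := Real.sqrt_pos.mpr hw
    have h1 : ((1 - 0) / w.im : ℂ) = (((√w.im)⁻¹ ^ 2 : ℝ) : ℂ) := by
      rw [inv_pow, Real.sq_sqrt hw.le]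
      push_cast
      simp
    have hs' : (√w.im : ℂ) ≠ 0 := by exact_mod_cast hs.ne'
    have hpi : (Real.pi : ℂ) ≠ 0 := by exact_mod_cast Real.pi_ne_zero
    rw [h1, powFiveHalves_ofReal_sq (inv_pos.mpr hs)]
    have : cayley w 0 = w := by simp [cayley]
    rw [this]
    push_cast
    field_simp
  · intro ζ hζ
    apply DifferentiableAt.differentiableWithinAt
    have h0 := one_sub_ne_zero_of_mem_ball hζ
    have h1 : (w.im : ℂ) ≠ 0 := by exact_mod_cast hw.ne'
    have hsl : (1 - ζ) / w.im ∈ slitPlane := by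
      left
      rw [← two_I_div_cayley hw hζ]
      exact two_I_div_re_pos (cayley_mem hw hζ) hw
    have hd : DifferentiableAt ℂ (fun ζ : ℂ => (1 - ζ) / w.im) ζ := by fun_prop
    have hc : DifferentiableAt ℂ (fun ζ => f (cayley w ζ)) ζ :=
      (hf.differentiableAt (isOpen_upperHalf.mem_nhds (cayley_mem hw hζ))).comp ζ
        (hasDerivAt_cayley w hζ).differentiableAt
    have hp : DifferentiableAt ℂ (fun ζ : ℂ => powFiveHalves ((1 - ζ) / w.im)) ζ :=
      DifferentiableAt.comp (f := fun ζ : ℂ => (1 - ζ) / w.im) ζ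
        (differentiableAt_powFiveHalves hsl) hd
    exact ((hp.fun_inv (powFiveHalves_ne_zero (div_ne_zero h0 h1))).const_mul _).mul hc

/-- In Cayley coordinates the squared kernel cancels the factor `|1 - ζ|⁻⁵` of the weight, leaving a
continuous function on the closed disc. -/
theorem memLp_bergmanKernel {w : ℂ} (hw : 0 < w.im) : MemLp (bergmanKernel w) 2 muHalf := by
  have hm : AEStronglyMeasurable (bergmanKernel w) muHalf :=
    ((differentiableOn_bergmanKernel hw).continuousOn.aestronglyMeasurable
      measurableSet_upperHalf).mono_ac muHalf_absolutelyContinuous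
  rw [memLp_two_iff_integrable_sq_norm hm, integrable_muHalf_iff,
    integrableOn_upperHalf_iff_cayley hw]
  have hb : IntegrableOn
      (fun ζ : ℂ => (3 / (8 * Real.pi)) ^ 2 * (4 / (√w.im) ^ 5) * √(1 - ‖ζ‖ ^ 2))
      (Metric.ball 0 1) :=
    ((by fun_prop : Continuous (fun ζ : ℂ =>
      (3 / (8 * Real.pi)) ^ 2 * (4 / (√w.im) ^ 5) *
        √(1 - ‖ζ‖ ^ 2))).continuousOn.integrableOn_compact (isCompact_closedBall (0 : ℂ) 1)).mono_set Metric.ball_subset_closedBall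
  refine (integrableOn_congr_fun (fun ζ hζ => ?_) measurableSet_ball).mpr hb
  have h0 : ‖1 - ζ‖ ≠ 0 := norm_ne_zero_iff.mpr (one_sub_ne_zero_of_mem_ball hζ)
  have hs := Real.sqrt_pos.mpr hw
  simp only [smul_eq_mul]
  rw [← mul_assoc, sqrt_weight_cayley hw hζ, bergmanKernel, two_I_div_cayley hw hζ, norm_mul,
    mul_pow, norm_powFiveHalves_sq, Complex.norm_real, Real.norm_of_nonneg (by positivity),
    norm_div, Complex.norm_real, Real.norm_of_nonneg hw.le, div_pow _ _ 2, div_pow _ _ 5]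
  rw [show w.im ^ 5 = √w.im ^ 10 by
      conv_lhs => rw [← Real.sq_sqrt hw.le]
      ring]
  field_simp

/-- The reproducing kernel, as an element of the Bergman space. -/
def bergmanKernelLp (w : upperHalf) : bergmanHalf :=
  ⟨(memLp_bergmanKernel w.2).toLp _, bergmanKernel w, differentiableOn_bergmanKernel w.2,
    (memLp_bergmanKernel w.2).coeFn_toLp⟩

theorem inner_bergmanKernelLp (w : upperHalf) {F : Lp ℂ 2 muHalf} {f : ℂ → ℂ}
    (hf : DifferentiableOn ℂ f upperHalf) (hF : F =ᵐ[muHalf] f) :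
    inner ℂ (bergmanKernelLp w : Lp ℂ 2 muHalf) F = f w := by
  have hae : (fun z => inner ℂ ((bergmanKernelLp w : Lp ℂ 2 muHalf) z) (F z)) =ᵐ[muHalf]
      fun z => conj (bergmanKernel w z) * f z := by
    filter_upwards [hF, (memLp_bergmanKernel w.2).coeFn_toLp] with z h1 h2
    rw [bergmanKernelLp, h2, h1, RCLike.inner_apply, mul_comm]
  rw [L2.inner_def, integral_congr_ae hae, integral_conj_bergmanKernel_mul w.2 hf]
  exact (integrable_congr hae).mp (L2.integrable_inner _ _)

theorem inner_bergmanKernelLp_bergmanKernelLp (z w : upperHalf) :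
    inner ℂ (bergmanKernelLp z) (bergmanKernelLp w) = bergmanKernel w z :=
  inner_bergmanKernelLp z (differentiableOn_bergmanKernel w.2)
    (memLp_bergmanKernel w.2).coeFn_toLp

/-- Since `‖k_w‖² = k_w(w)`, the norm is controlled by the height alone, which turns L² convergence
into locally uniform convergence. The fourth power avoids half-integer exponents, and `x ≤ 1 + x⁴`
suffices because only some bound is needed. -/
theorem norm_bergmanKernelLp_le {δ : ℝ} (hδ : 0 < δ) {w : upperHalf} (hw : δ ≤ (w : ℂ).im) :
    ‖bergmanKernelLp w‖ ≤ 1 + (3 / (8 * Real.pi)) ^ 2 / δ ^ 5 := by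
  have hw0 : 0 < (w : ℂ).im := w.2
  have h1 : ‖bergmanKernelLp w‖ ^ 2 = ‖bergmanKernel w w‖ := by
    rw [← inner_bergmanKernelLp_bergmanKernelLp,
      inner_self_eq_norm_sq_to_K (𝕜 := ℂ) (bergmanKernelLp w), norm_pow]
    simp
  have h2 : ‖bergmanKernelLp w‖ ^ 4 = (3 / (8 * Real.pi)) ^ 2 / (w : ℂ).im ^ 5 := by
    have h3 : 2 * I / ((w : ℂ) - conj (w : ℂ)) = ((1 / (w : ℂ).im : ℝ) : ℂ) := by
      have : ((w : ℂ).im : ℂ) ≠ 0 := by exact_mod_cast hw0.ne'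
      rw [Complex.sub_conj]
      push_cast
      field_simp
    rw [show ‖bergmanKernelLp w‖ ^ 4 = (‖bergmanKernelLp w‖ ^ 2) ^ 2 by ring, h1, bergmanKernel,
      norm_mul, mul_pow, norm_powFiveHalves_sq, h3, Complex.norm_real, Complex.norm_real,
      Real.norm_of_nonneg (by positivity), Real.norm_of_nonneg (by positivity)]
    field_simp
  have h4 : (3 / (8 * Real.pi)) ^ 2 / (w : ℂ).im ^ 5 ≤ (3 / (8 * Real.pi)) ^ 2 / δ ^ 5 := by
    gcongr
  have h5 := norm_nonneg (bergmanKernelLp w)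
  nlinarith [sq_nonneg (‖bergmanKernelLp w‖ - 1), sq_nonneg (‖bergmanKernelLp w‖ ^ 2 - 1)]

/-! ### Completeness of the Bergman space and totality of its kernels -/

/-- The L² limit `G` has the candidate representative `z ↦ ⟨k_z, G⟩`. The holomorphic
representatives converge to it locally uniformly, so it is holomorphic, and an almost everywhere
convergent subsequence identifies it with `G`. -/
theorem isClosed_bergmanHalf : IsClosed (bergmanHalf : Set (Lp ℂ 2 muHalf)) := by
  classical
  apply IsSeqClosed.isClosed
  intro F G hF hFG
  choose f hfd hFf using hF
  set g : ℂ → ℂ := fun z => if hz : z ∈ upperHalf then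
    inner ℂ (bergmanKernelLp ⟨z, hz⟩ : Lp ℂ 2 muHalf) G else 0 with hg
  have hfz : ∀ n, ∀ z (hz : z ∈ upperHalf),
      f n z = inner ℂ (bergmanKernelLp ⟨z, hz⟩ : Lp ℂ 2 muHalf) (F n) :=
    fun n z hz => (inner_bergmanKernelLp ⟨z, hz⟩ (hfd n) (hFf n)).symm
  have hunif : TendstoLocallyUniformlyOn f g atTop upperHalf := by
    rw [Metric.tendstoLocallyUniformlyOn_iff]
    intro ε hε z hz
    have hz' : 0 < z.im := hz
    refine ⟨{x : ℂ | z.im / 2 < x.im},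
      mem_nhdsWithin_of_mem_nhds ((isOpen_lt continuous_const continuous_im).mem_nhds ?_), ?_⟩
    · change z.im / 2 < z.im
      linarith
    set M := 1 + (3 / (8 * Real.pi)) ^ 2 / (z.im / 2) ^ 5
    have hM : 0 < M := by positivity
    filter_upwards [Metric.tendsto_atTop'.mp hFG (ε / M) (by positivity) |>.elim
      fun N hN => (eventually_gt_atTop N).mono hN] with n hn y hy
    have hyu : y ∈ upperHalf := by
      change 0 < y.im
      have : z.im / 2 < y.im := hy
      linarith
    rw [hfz n y hyu, hg]
    simp only [dif_pos hyu]
    rw [dist_eq_norm, ← inner_sub_right]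
    refine (norm_inner_le_norm _ _).trans_lt ?_
    have h1 : ‖(bergmanKernelLp ⟨y, hyu⟩ : Lp ℂ 2 muHalf)‖ ≤ M :=
      norm_bergmanKernelLp_le (w := ⟨y, hyu⟩) (by positivity) (le_of_lt hy)
    rw [dist_comm, dist_eq_norm] at hn
    calc _ ≤ M * ‖G - F n‖ := by gcongr
      _ < M * (ε / M) := by gcongr
      _ = ε := by field_simp
  refine ⟨g, hunif.differentiableOn (Eventually.of_forall hfd) isOpen_upperHalf, ?_⟩
  obtain ⟨ns, hns, hae⟩ := (tendstoInMeasure_of_tendsto_Lp hFG).exists_seq_tendsto_ae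
  filter_upwards [hae, ae_all_iff.mpr hFf, ae_mem_upperHalf] with z h1 h2 hz
  refine tendsto_nhds_unique h1 ?_
  simp only [h2]
  exact (hunif.tendsto_at hz).comp hns.tendsto_atTop

instance : CompleteSpace bergmanHalf := isClosed_bergmanHalf.completeSpace_coe

theorem bergmanHalf_eq_zero_of_inner {F : bergmanHalf}
    (h : ∀ w, inner ℂ (bergmanKernelLp w) F = 0) : F = 0 := by
  obtain ⟨f, hf, hFf⟩ := F.2
  have hz : ∀ z ∈ upperHalf, f z = 0 := by
    intro z hz
    rw [← inner_bergmanKernelLp ⟨z, hz⟩ hf hFf]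
    exact h ⟨z, hz⟩
  apply Subtype.ext
  apply Lp.ext
  filter_upwards [hFf, Lp.coeFn_zero ℂ 2 muHalf, ae_mem_upperHalf] with z h1 h2 h3
  rw [h1, hz z h3]
  exact h2.symm

/-! ### Unitary operators from equal Gram matrices -/

section Gram

variable {X E H : Type*} [NormedAddCommGroup E] [InnerProductSpace ℂ E]
  [NormedAddCommGroup H] [InnerProductSpace ℂ H]

theorem denseRange_linearCombination_of_inner_eq_zero [CompleteSpace E] {e : X → E}
    (he : ∀ x : E, (∀ i, inner ℂ (e i) x = 0) → x = 0) :
    DenseRange (Finsupp.linearCombination ℂ e) := by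
  have h1 : (Submodule.span ℂ (Set.range e)).topologicalClosure = ⊤ := by
    rw [Submodule.topologicalClosure_eq_top_iff, Submodule.eq_bot_iff]
    intro x hx
    exact he x fun i => hx _ (Submodule.subset_span (Set.mem_range_self i))
  rw [DenseRange, ← LinearMap.coe_range, Finsupp.range_linearCombination]
  exact Submodule.dense_iff_topologicalClosure_eq_top.mpr h1

theorem inner_linearCombination_linearCombination (e : X → E) (x y : X →₀ ℂ) :
    inner ℂ (Finsupp.linearCombination ℂ e x) (Finsupp.linearCombination ℂ e y) =
      ∑ i ∈ x.support, ∑ j ∈ y.support, conj (x i) * (y j * inner ℂ (e i) (e j)) := by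
  simp only [Finsupp.linearCombination_apply, Finsupp.sum, sum_inner, inner_sum, inner_smul_left,
    inner_smul_right, Finset.mul_sum]
  rw [Finset.sum_comm]
  simp only [mul_left_comm]

/-- Two total families of vectors with the same Gram matrix are related by a unitary operator. -/
theorem exists_linearIsometryEquiv_of_inner_eq [CompleteSpace E] [CompleteSpace H] {e : X → E}
    {k : X → H} (he : ∀ x : E, (∀ i, inner ℂ (e i) x = 0) → x = 0)
    (hk : ∀ x : H, (∀ i, inner ℂ (k i) x = 0) → x = 0)
    (hek : ∀ i j, inner ℂ (e i) (e j) = inner ℂ (k i) (k j)) :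
    ∃ U : E ≃ₗᵢ[ℂ] H, ∀ i, U (e i) = k i := by
  have hnorm : ∀ x, ‖Finsupp.linearCombination ℂ k (LinearEquiv.refl ℂ (X →₀ ℂ) x)‖ =
      ‖Finsupp.linearCombination ℂ e x‖ := by
    intro x
    rw [LinearEquiv.refl_apply, @norm_eq_sqrt_re_inner ℂ, @norm_eq_sqrt_re_inner ℂ E,
      inner_linearCombination_linearCombination, inner_linearCombination_linearCombination]
    simp only [hek]
  -- Both families map the finitely supported coefficients densely and induce the same seminorm
  -- there, so the identity on coefficients extends to a unitary.
  refine ⟨(LinearEquiv.refl ℂ (X →₀ ℂ)).extendOfIsometry _ _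
    (denseRange_linearCombination_of_inner_eq_zero he)
    (denseRange_linearCombination_of_inner_eq_zero hk) hnorm, fun i => ?_⟩
  have := LinearEquiv.extendOfIsometry_eq (LinearEquiv.refl ℂ (X →₀ ℂ)) _ _
    (denseRange_linearCombination_of_inner_eq_zero he)
    (denseRange_linearCombination_of_inner_eq_zero hk) hnorm (Finsupp.single i 1)
  simpa using this

end Gram

/-! ### Fourier uniqueness and the Gaussian kernels in even L² -/

-- Every test function is the Fourier transform of a Schwartz function `χ`, so moving the transform
-- onto `f` turns the pairing with `f` into the integral of `χ` against `𝓕 f = 0`.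
open FourierTransform in
theorem ae_eq_zero_of_fourier_eq_zero {f : ℝ → ℂ} (hf : Integrable f) (h : ∀ ξ, 𝓕 f ξ = 0) :
    ∀ᵐ x, f x = 0 := by
  refine ae_eq_zero_of_integral_contDiff_smul_eq_zero hf.locallyIntegrable fun g hg hgs => ?_
  have hg' : ContDiff ℝ ((⊤ : ℕ∞) : WithTop ℕ∞) (fun x => (g x : ℂ)) :=
    Complex.ofRealCLM.contDiff.comp hg
  have hgs' : HasCompactSupport (fun x => (g x : ℂ)) :=
    hgs.comp_left (g := fun x : ℝ => (x : ℂ)) Complex.ofReal_zero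
  set φ : 𝓢(ℝ, ℂ) := hgs'.toSchwartzMap hg'
  have hφ : ∀ x, φ x = g x := fun x => rfl
  set χ : 𝓢(ℝ, ℂ) := 𝓕⁻ φ with hχ
  have hχφ : 𝓕 χ = φ := FourierTransform.fourier_fourierInv_eq φ
  have key := VectorFourier.integral_fourierIntegral_smul_eq_flip (L := innerₗ ℝ)
    (μ := volume) (ν := volume) Real.continuous_fourierChar continuous_inner
    χ.integrable hf
  have h1 : ∀ ξ, VectorFourier.fourierIntegral Real.fourierChar volume (innerₗ ℝ) χ ξ =
      φ ξ := by
    intro ξ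
    rw [← hχφ]
    rfl
  have h2 : ∀ ξ, VectorFourier.fourierIntegral Real.fourierChar volume (innerₗ ℝ).flip f ξ = 0 := by
    intro ξ
    rw [← h ξ, flip_innerₗ]
    rfl
  simp only [h1, h2, hφ, smul_zero, integral_zero] at key
  simpa using key

theorem integral_eq_two_mul_integral_Ioi_of_even {f : ℝ → ℂ} (hi : Integrable f)
    (hf : (fun p => f (-p)) =ᵐ[volume] f) : ∫ p, f p = 2 * ∫ p in Set.Ioi 0, f p := by
  have h1 : ∫ p in Set.Iic 0, f p = ∫ p in Set.Ioi 0, f p := by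
    have h2 := integral_comp_neg_Iic 0 f
    rw [neg_zero] at h2
    rw [← h2]
    apply integral_congr_ae
    filter_upwards [ae_restrict_of_ae hf] with p hp using hp.symm
  rw [← integral_add_compl measurableSet_Ioi hi, Set.compl_Ioi, h1]
  ring

/-- The normalized kernel of the transform, as a function in `L²(ℝ)`: the transform at `w` is the
inner product with this function. -/
def gaussianKernel (w : ℂ) (p : ℝ) : ℂ :=
  cE * ((p : ℂ) ^ 2 * cexp (-(I * conj w * (p : ℂ) ^ 2 / 2)))

theorem norm_exp_gaussianKernel (w : ℂ) (p : ℝ) :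
    ‖cexp (-(I * conj w * (p : ℂ) ^ 2 / 2))‖ = Real.exp (-(w.im / 2) * p ^ 2) := by
  rw [Complex.norm_exp]
  congr 1
  simp [← Complex.ofReal_pow]
  ring

theorem continuous_gaussianKernel (w : ℂ) : Continuous (gaussianKernel w) := by
  unfold gaussianKernel
  fun_prop

theorem integrable_pow_mul_exp_neg_mul_sq (n : ℕ) {b : ℝ} (hb : 0 < b) :
    Integrable fun p : ℝ => p ^ n * Real.exp (-b * p ^ 2) := by
  have := integrable_rpow_mul_exp_neg_mul_sq hb (s := n) (by linarith [n.cast_nonneg (α := ℝ)])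
  simpa only [Real.rpow_natCast] using this

theorem memLp_gaussianKernel {w : ℂ} (hw : 0 < w.im) : MemLp (gaussianKernel w) 2 volume := by
  rw [memLp_two_iff_integrable_sq_norm (continuous_gaussianKernel w).aestronglyMeasurable]
  refine ((integrable_pow_mul_exp_neg_mul_sq 4 hw).const_mul (cE ^ 2)).congr
    (Eventually.of_forall fun p => ?_)
  simp only [gaussianKernel, norm_mul, norm_exp_gaussianKernel, mul_pow, ← Real.exp_nat_mul,
    norm_pow, Complex.norm_real, Real.norm_eq_abs, sq_abs]
  rw [← pow_mul, ← Even.pow_abs (by decide : Even (2 * 2))]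
  push_cast
  congr 3
  ring

/-- `gaussianKernel`, as an element of `L²`. -/
def gaussianKernelLp (w : upperHalf) : evenL2 :=
  ⟨(memLp_gaussianKernel w.2).toLp _, by
    have h := (memLp_gaussianKernel w.2).coeFn_toLp
    have h' := (Measure.measurePreserving_neg (volume : Measure ℝ)).quasiMeasurePreserving.ae h
    change _ =ᵐ[volume] _
    filter_upwards [h, h'] with p h1 h2
    rw [h1, h2]
    simp [gaussianKernel]⟩

theorem conj_gaussianKernel_mul (ψ : ℝ → ℂ) (z : ℂ) (p : ℝ) :
    conj (gaussianKernel z p) * ψ p = cE * kernelE ψ z p := by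
  simp only [gaussianKernel, kernelE, map_mul, ← Complex.exp_conj, map_neg, map_div₀, map_pow,
    Complex.conj_ofReal, Complex.conj_I, Complex.conj_conj, map_ofNat]
  ring_nf

theorem integrable_kernelE_of_memLp {ψ : ℝ → ℂ} (hψ : MemLp ψ 2 volume) {z : ℂ}
    (hz : z ∈ upperHalf) : Integrable (kernelE ψ z) volume := by
  have h := (memLp_gaussianKernel hz).star.integrable_mul hψ
  have hc : (cE : ℂ) ≠ 0 := by
    have : cE ≠ 0 := by unfold cE; positivity
    exact_mod_cast this
  refine (integrable_const_mul_iff (isUnit_iff_ne_zero.mpr hc) _).mp (h.congr ?_)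
  exact Eventually.of_forall fun p => conj_gaussianKernel_mul ψ z p

theorem transformE_congr {φ ψ : ℝ → ℂ} (h : φ =ᵐ[volume] ψ) : transformE φ = transformE ψ := by
  ext z
  unfold transformE
  congr 1
  apply integral_congr_ae
  filter_upwards [h] with p hp
  simp [kernelE, hp]

theorem inner_gaussianKernelLp (z : upperHalf) (ψ : evenL2) :
    inner ℂ (gaussianKernelLp z) ψ = transformE (ψ : Lp ℂ 2 (volume : Measure ℝ)) z := by
  change inner ℂ (gaussianKernelLp z : Lp ℂ 2 (volume : Measure ℝ)) ψ = _
  rw [L2.inner_def, transformE, ← integral_const_mul]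
  apply integral_congr_ae
  filter_upwards [(memLp_gaussianKernel z.2).coeFn_toLp] with p hp
  rw [← conj_gaussianKernel_mul, gaussianKernelLp, hp, RCLike.inner_apply, mul_comm]

theorem integrable_pow_mul_cexp_neg_mul_sq (n : ℕ) {r : ℂ} (hr : 0 < r.re) :
    Integrable fun p : ℝ => (p : ℂ) ^ n * cexp (-r * p ^ 2) := by
  refine (integrable_norm_iff (by fun_prop : Continuous
    fun p : ℝ => (p : ℂ) ^ n * cexp (-r * p ^ 2)).aestronglyMeasurable).mp ?_
  refine (integrable_pow_mul_exp_neg_mul_sq n hr).norm.congr (Eventually.of_forall fun p => ?_)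
  simp [Complex.norm_exp, ← Complex.ofReal_pow]

/-- The derivative of `p^(n+1) exp(-r p²)` integrates to zero. Two uses reduce the fourth moment to
the Gaussian integral. -/
theorem integral_pow_add_two_mul_cexp (n : ℕ) {r : ℂ} (hr : 0 < r.re) :
    ∫ p : ℝ, (p : ℂ) ^ (n + 2) * cexp (-r * p ^ 2) =
      (n + 1) / (2 * r) * ∫ p : ℝ, (p : ℂ) ^ n * cexp (-r * p ^ 2) := by
  have hr0 : r ≠ 0 := by rintro rfl; simp at hr
  have hd : ∀ p : ℝ, HasDerivAt (fun p : ℝ => (p : ℂ) ^ (n + 1) * cexp (-r * p ^ 2))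
      ((n + 1) * ((p : ℂ) ^ n * cexp (-r * p ^ 2)) -
        2 * r * ((p : ℂ) ^ (n + 2) * cexp (-r * p ^ 2))) p := by
    intro p
    have h1 : HasDerivAt (fun z : ℂ => z ^ (n + 1) * cexp (-r * z ^ 2)) _ (p : ℂ) :=
      (hasDerivAt_pow (n + 1) (p : ℂ)).mul (((hasDerivAt_pow 2 (p : ℂ)).const_mul (-r)).cexp)
    refine h1.comp_ofReal.congr_deriv ?_
    push_cast
    ring
  have i0 := integrable_pow_mul_cexp_neg_mul_sq n hr
  have i1 := integrable_pow_mul_cexp_neg_mul_sq (n + 1) hr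
  have i2 := integrable_pow_mul_cexp_neg_mul_sq (n + 2) hr
  have h0 := integral_eq_zero_of_hasDerivAt_of_integrable hd
    ((i0.const_mul _).sub (i2.const_mul _)) i1
  rw [integral_sub (i0.const_mul _) (i2.const_mul _), integral_const_mul, integral_const_mul,
    sub_eq_zero] at h0
  rw [div_mul_eq_mul_div, h0]
  field_simp

theorem cE_sq : cE ^ 2 = 1 / (2 * Real.pi * √Real.pi) := by
  have h : (Real.pi ^ (3 / 4 : ℝ)) ^ 2 = Real.pi * √Real.pi := by
    rw [← Real.rpow_natCast, ← Real.rpow_mul Real.pi_pos.le, Real.sqrt_eq_rpow]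
    conv_rhs => rw [← Real.rpow_one_add' Real.pi_pos.le (by norm_num)]
    norm_num
  rw [cE, div_pow, mul_pow, h, Real.sq_sqrt (by norm_num)]
  ring

/-- The product of the two Gaussians is `exp(-r p²)` with `r⁻¹ = 2i/(z - w̄)`. Its fourth moment is
`(3/(4r²)) √(π/r)`, and `cE² = 1/(2π√π)` turns the constant into `3/(8π)`. -/
theorem inner_gaussianKernelLp_gaussianKernelLp (z w : upperHalf) :
    inner ℂ (gaussianKernelLp z) (gaussianKernelLp w) = bergmanKernel w z := by
  set q : ℂ := 2 * I / (z - conj (w : ℂ)) with hq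
  set r : ℂ := -(I * (z - conj (w : ℂ)) / 2) with hr
  have hne := sub_conj_ne_zero z.2 w.2
  have hrq : r⁻¹ = q := by
    rw [hr, hq]
    have := Complex.I_ne_zero
    field_simp
    simp
  have hrre : 0 < r.re := by
    have h1 : 0 < (z : ℂ).im := z.2
    have h2 : 0 < (w : ℂ).im := w.2
    rw [hr]
    simp
    linarith
  have hr0 : r ≠ 0 := by rintro h; simp [h] at hrre
  have hint : inner ℂ (gaussianKernelLp z) (gaussianKernelLp w) =
      (cE : ℂ) ^ 2 * ∫ p : ℝ, (p : ℂ) ^ (2 + 2) * cexp (-r * p ^ 2) := by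
    rw [inner_gaussianKernelLp, gaussianKernelLp,
      transformE_congr (memLp_gaussianKernel w.2).coeFn_toLp, transformE,
      pow_two, mul_assoc]
    congr 1
    rw [← integral_const_mul]
    congr 1
    ext p
    simp only [kernelE, gaussianKernel]
    have : -r * (p : ℂ) ^ 2 = I * z * p ^ 2 / 2 + -(I * conj (w : ℂ) * p ^ 2 / 2) := by
      rw [hr]
      ring
    rw [this, Complex.exp_add]
    ring
  have h0 := integral_pow_add_two_mul_cexp 0 hrre
  simp only [pow_zero, one_mul, zero_add] at h0
  rw [hint, integral_pow_add_two_mul_cexp 2 hrre, h0, integral_gaussian_complex hrre]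
  -- The principal root splits here because one factor is a positive real, so the argument does not
  -- change.
  have hsqrt : (Real.pi / r : ℂ) ^ (1 / 2 : ℂ) = (√Real.pi : ℂ) * q ^ (1 / 2 : ℂ) := by
    have hq0 : q ≠ 0 := hrq ▸ inv_ne_zero hr0
    have hpi : (Real.pi : ℂ) ≠ 0 := by exact_mod_cast Real.pi_ne_zero
    rw [div_eq_mul_inv, hrq, Complex.cpow_def_of_ne_zero (mul_ne_zero hpi hq0),
      Complex.log_ofReal_mul Real.pi_pos hq0, add_mul, Complex.exp_add,
      ← Complex.cpow_def_of_ne_zero hq0, Complex.ofReal_log Real.pi_pos.le,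
      ← Complex.cpow_def_of_ne_zero hpi, Real.sqrt_eq_rpow, Complex.ofReal_cpow Real.pi_pos.le]
    norm_num
  rw [hsqrt, bergmanKernel, powFiveHalves, ← hq, ← Complex.ofReal_pow, cE_sq, ← hrq]
  have hpi : (Real.pi : ℂ) ≠ 0 := by exact_mod_cast Real.pi_ne_zero
  have hspi : (√Real.pi : ℂ) ≠ 0 := by exact_mod_cast (Real.sqrt_pos.mpr Real.pi_pos).ne'
  push_cast
  field_simp
  norm_num
  ring

/-! ### The even subspace: closedness, density, totality -/

/-- The reflection `ψ(p) ↦ ψ(-p)` of `L²(ℝ)`. -/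
def reflectionLp : Lp ℂ 2 (volume : Measure ℝ) →ₗᵢ[ℂ] Lp ℂ 2 (volume : Measure ℝ) :=
  Lp.compMeasurePreservingₗᵢ ℂ Neg.neg (Measure.measurePreserving_neg volume)

theorem coeFn_reflectionLp (ψ : Lp ℂ 2 (volume : Measure ℝ)) :
    reflectionLp ψ =ᵐ[volume] fun p => ψ (-p) :=
  Lp.coeFn_compMeasurePreserving ψ _

theorem mem_evenL2_iff {ψ : Lp ℂ 2 (volume : Measure ℝ)} :
    ψ ∈ evenL2 ↔ reflectionLp ψ = ψ := by
  constructor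
  · intro h
    exact Lp.ext ((coeFn_reflectionLp ψ).trans h)
  · intro h
    have := coeFn_reflectionLp ψ
    rw [h] at this
    exact this.symm

theorem isClosed_evenL2 : IsClosed (evenL2 : Set (Lp ℂ 2 (volume : Measure ℝ))) := by
  have : (evenL2 : Set (Lp ℂ 2 (volume : Measure ℝ))) = {ψ | reflectionLp ψ = ψ} :=
    Set.ext fun _ => mem_evenL2_iff
  rw [this]
  exact isClosed_eq reflectionLp.continuous continuous_id

instance : CompleteSpace evenL2 := isClosed_evenL2.completeSpace_coe

/-- Averaging a Schwartz approximant with its reflection does not increase the error, since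
reflection is an isometry fixing the even target. -/
theorem denseRange_evenSchwartzToL2 : DenseRange evenSchwartzToL2 := by
  rw [Metric.denseRange_iff]
  intro ψ ε hε
  obtain ⟨s, hs⟩ := Metric.denseRange_iff.mp
    (SchwartzMap.denseRange_toLpCLM (F := ℂ) (p := 2) (μ := (volume : Measure ℝ)) (by norm_num))
    (ψ : Lp ℂ 2 (volume : Measure ℝ)) ε hε
  set t : 𝓢(ℝ, ℂ) :=
    SchwartzMap.compCLMOfContinuousLinearEquiv ℂ (ContinuousLinearEquiv.neg ℝ) s with ht
  have htp : ∀ p, t p = s (-p) := fun p => rfl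
  refine ⟨⟨(1 / 2 : ℂ) • (s + t), fun p => ?_⟩, ?_⟩
  · simp [htp, add_comm]
  · set S : Lp ℂ 2 (volume : Measure ℝ) := SchwartzMap.toLpCLM ℝ ℂ 2 volume s with hS
    have hrS : reflectionLp S = t.toLp 2 volume := by
      apply Lp.ext
      have h' := (Measure.measurePreserving_neg (volume : Measure ℝ)).quasiMeasurePreserving.ae
        (s.coeFn_toLp 2 volume)
      filter_upwards [coeFn_reflectionLp S, h', t.coeFn_toLp 2 volume] with p h1 h2 h3
      rw [h1, h3, htp, ← h2]
      rfl
    have hev : ((1 / 2 : ℂ) • (s + t)).toLp 2 volume = (1 / 2 : ℂ) • (S + reflectionLp S) := by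
      rw [hrS]
      have := map_smul (SchwartzMap.toLpCLM ℂ ℂ 2 (volume : Measure ℝ)) (1 / 2 : ℂ) (s + t)
      rw [map_add] at this
      exact this
    have hψ := mem_evenL2_iff.mp ψ.2
    rw [dist_comm, Subtype.dist_eq]
    change dist (((1 / 2 : ℂ) • (s + t)).toLp 2 volume) _ < ε
    rw [hev, dist_eq_norm]
    have : (1 / 2 : ℂ) • (S + reflectionLp S) - (ψ : Lp ℂ 2 (volume : Measure ℝ)) =
        (1 / 2 : ℂ) • ((S - ψ) + reflectionLp (S - ψ)) := by
      rw [map_sub, hψ]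
      module
    rw [this, norm_smul]
    rw [dist_comm, dist_eq_norm] at hs
    calc _ ≤ ‖(1 / 2 : ℂ)‖ * (‖S - ψ‖ + ‖reflectionLp (S - ψ)‖) := by
          gcongr
          exact norm_add_le _ _
      _ = ‖S - ψ‖ := by
          rw [LinearIsometry.norm_map]
          norm_num
          ring
      _ < ε := hs

open FourierTransform in
/-- An even integrable function is determined by the Fourier transform in the variable `p²`. -/
theorem ae_eq_zero_of_integral_exp_sq_eq_zero {h : ℝ → ℂ} (hi : Integrable h)
    (he : (fun p => h (-p)) =ᵐ[volume] h)
    (hz : ∀ b : ℝ, ∫ p : ℝ, cexp (I * b * (p : ℂ) ^ 2 / 2) * h p = 0) : ∀ᵐ p, h p = 0 := by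
  -- The density of `h` on the half-line in the variable `t = p²`. By evenness its Fourier transform
  -- at `ξ` is half the integral in `hz` at `b = -4πξ`.
  set H : ℝ → ℂ := (Set.Ioi (0 : ℝ)).indicator
    fun t => ((1 / 2 : ℝ) * t ^ ((1 / 2 : ℝ) - 1)) • h (t ^ (1 / 2 : ℝ)) with hH
  have hHi : Integrable H := by
    rw [hH, integrable_indicator_iff measurableSet_Ioi]
    have := (integrableOn_Ioi_comp_rpow_iff h (p := 1 / 2) (by norm_num)).mpr hi.integrableOn
    rwa [abs_of_pos (by norm_num)] at this
  have hexp : ∀ b : ℝ, Integrable fun p : ℝ => cexp (I * b * (p : ℂ) ^ 2 / 2) * h p := by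
    intro b
    refine hi.bdd_mul (c := 1) (by fun_prop) (Eventually.of_forall fun p => ?_)
    rw [Complex.norm_exp]
    simp [← Complex.ofReal_pow]
  have hF : ∀ ξ, 𝓕 H ξ = 0 := by
    intro ξ
    rw [Real.fourier_real_eq_integral_exp_smul]
    have hind : (fun t : ℝ => cexp (↑(-2 * Real.pi * t * ξ) * I) • H t) =
        (Set.Ioi (0 : ℝ)).indicator fun t => ((1 / 2 : ℝ) * t ^ ((1 / 2 : ℝ) - 1)) •
          (cexp (I * (-4 * Real.pi * ξ : ℝ) * ((t ^ (1 / 2 : ℝ) : ℝ) : ℂ) ^ 2 / 2) *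
            h (t ^ (1 / 2 : ℝ))) := by
      ext t
      by_cases ht : t ∈ Set.Ioi (0 : ℝ)
      · rw [Set.indicator_of_mem ht, hH, Set.indicator_of_mem ht, ← Real.sqrt_eq_rpow,
          ← Complex.ofReal_pow, Real.sq_sqrt (le_of_lt ht), smul_comm, smul_eq_mul]
        congr 3
        push_cast
        ring
      · rw [Set.indicator_of_notMem ht, hH, Set.indicator_of_notMem ht, smul_zero]
    rw [hind, integral_indicator measurableSet_Ioi, integral_comp_rpow_Ioi_of_pos
      (g := fun p : ℝ => cexp (I * (-4 * Real.pi * ξ : ℝ) * (p : ℂ) ^ 2 / 2) * h p) (by norm_num)]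
    have h2 := integral_eq_two_mul_integral_Ioi_of_even (hexp (-4 * Real.pi * ξ)) (by
      filter_upwards [he] with p hp
      simp [hp])
    rw [hz] at h2
    simpa using h2.symm
  have hH0 := ae_eq_zero_of_fourier_eq_zero hHi hF
  -- Substituting in the integral of the norm carries the vanishing of `H` back to `h` without
  -- tracking null sets under the square root.
  have hnorm : ∫ p in Set.Ioi (0 : ℝ), ‖h p‖ = 0 := by
    rw [← integral_comp_rpow_Ioi_of_pos (g := fun p => ‖h p‖) (p := 1 / 2) (by norm_num)]
    rw [setIntegral_eq_zero_of_ae_eq_zero]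
    filter_upwards [hH0] with t ht htp
    rw [hH, Set.indicator_of_mem htp] at ht
    have := congrArg norm ht
    rw [norm_smul, norm_zero, Real.norm_of_nonneg
      (mul_nonneg (by norm_num) (Real.rpow_nonneg (le_of_lt htp) _))] at this
    exact this
  rw [setIntegral_eq_zero_iff_of_nonneg_ae (Eventually.of_forall fun p => norm_nonneg _)
    hi.norm.integrableOn, Filter.EventuallyEq, ae_restrict_iff' measurableSet_Ioi] at hnorm
  have hneg := (Measure.measurePreserving_neg (volume : Measure ℝ)).quasiMeasurePreserving.ae hnorm
  filter_upwards [hnorm, hneg, he, Measure.ae_ne volume (0 : ℝ)] with p h1 h2 h3 h4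
  rcases lt_or_gt_of_ne h4 with h5 | h5
  · rw [← h3]
    simpa using h2 (by simpa using h5)
  · simpa using h1 h5

/-- The line `Im z = 1` is enough: there the pairings are the integrals of `exp(i b p²/2)` against
the integrable even function `p² exp(-p²/2) g(p)`, whose factor in front of `g` vanishes only at 0.
-/
theorem evenL2_eq_zero_of_inner {g : evenL2}
    (h : ∀ z, inner ℂ (gaussianKernelLp z) g = 0) : g = 0 := by
  have hc : (cE : ℂ) ≠ 0 := by
    have : cE ≠ 0 := by unfold cE; positivity
    exact_mod_cast this
  set G : ℝ → ℂ := ((g : Lp ℂ 2 (volume : Measure ℝ)) : ℝ → ℂ) with hG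
  have hI : I ∈ upperHalf := by simp [upperHalf]
  have hzero := ae_eq_zero_of_integral_exp_sq_eq_zero (h := kernelE G I)
    (integrable_kernelE_of_memLp (Lp.memLp _) hI) (by
      have := g.2
      filter_upwards [this] with p hp
      simp only [kernelE, hG, hp]
      simp) (fun b => by
      have hb : (b : ℂ) + I ∈ upperHalf := by simp [upperHalf]
      have h1 := h ⟨_, hb⟩
      rw [inner_gaussianKernelLp, transformE] at h1
      refine Eq.trans ?_ ((mul_eq_zero.mp h1).resolve_left hc)
      congr 1
      ext p
      simp only [kernelE]
      rw [show I * ((b : ℂ) + I) * (p : ℂ) ^ 2 / 2 = I * b * p ^ 2 / 2 + I * I * p ^ 2 / 2 by ring,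
        Complex.exp_add]
      ring)
  apply Subtype.ext
  apply Lp.ext
  filter_upwards [hzero, Lp.coeFn_zero ℂ 2 (volume : Measure ℝ), Measure.ae_ne volume (0 : ℝ)]
    with p h1 h2 h3
  refine Eq.trans ?_ h2.symm
  simpa [kernelE, h3] using h1

/-! ### The unitary transform -/

/-- The transform is the unitary operator that maps the vectors `gaussianKernelLp z` to the
reproducing kernels of the Bergman space. -/
theorem exists_unitary_transformE : ∃ U : evenL2 ≃ₗᵢ[ℂ] bergmanHalf, ∀ ψ : evenL2,
    DifferentiableOn ℂ (transformE (ψ : Lp ℂ 2 (volume : Measure ℝ))) upperHalf ∧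
      (U ψ : Lp ℂ 2 muHalf) =ᵐ[muHalf] transformE (ψ : Lp ℂ 2 (volume : Measure ℝ)) := by
  obtain ⟨U, hU⟩ := exists_linearIsometryEquiv_of_inner_eq (e := gaussianKernelLp)
    (k := bergmanKernelLp) (fun _ => evenL2_eq_zero_of_inner)
    (fun _ => bergmanHalf_eq_zero_of_inner) (fun z w => by
      rw [inner_gaussianKernelLp_gaussianKernelLp, inner_bergmanKernelLp_bergmanKernelLp])
  refine ⟨U, fun ψ => ?_⟩
  obtain ⟨f, hf, hUf⟩ := (U ψ).2
  -- The holomorphic representative is evaluated by `⟨k_z, Uψ⟩ = ⟨U g_z, Uψ⟩ = ⟨g_z, ψ⟩`.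
  have heq : Set.EqOn (transformE (ψ : Lp ℂ 2 (volume : Measure ℝ))) f upperHalf := by
    intro z hz
    rw [← inner_bergmanKernelLp ⟨z, hz⟩ hf hUf]
    change _ = inner ℂ (bergmanKernelLp ⟨z, hz⟩) (U ψ)
    rw [← hU, LinearIsometryEquiv.inner_map_map, inner_gaussianKernelLp]
  refine ⟨hf.congr heq, ?_⟩
  filter_upwards [hUf, ae_mem_upperHalf] with z h1 h2
  rw [h1, heq h2]

theorem transformE_evenSchwartzToL2 (ψ : evenSchwartz) :
    transformE (evenSchwartzToL2 ψ : Lp ℂ 2 (volume : Measure ℝ)) = transformE (ψ : 𝓢(ℝ, ℂ)) :=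
  transformE_congr ((ψ : 𝓢(ℝ, ℂ)).coeFn_toLp 2 volume)

/-! ### The truncated inverse and its limit in L² -/

theorem isOpen_rectE (σ γ : ℝ) : IsOpen (rectE σ γ) :=
  (isOpen_lt continuous_re.abs continuous_const).and
    ((isOpen_lt continuous_const continuous_im).and (isOpen_lt continuous_im continuous_const))

instance : SFinite muHalf := by
  unfold muHalf
  infer_instance

theorem measurableSet_rectE (σ γ : ℝ) : MeasurableSet (rectE σ γ) :=
  (isOpen_rectE σ γ).measurableSet

theorem rectE_subset_upperHalf (σ : ℝ) {γ : ℝ} (hγ : 0 < γ) : rectE σ γ ⊆ upperHalf := fun _ hz =>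
  lt_trans (one_div_pos.mpr hγ) hz.2.1

theorem volume_rectE_lt_top (σ γ : ℝ) : volume (rectE σ γ) < ∞ := by
  refine (Bornology.IsBounded.reProdIm (Metric.isBounded_Ioo (-σ) σ)
    (Metric.isBounded_Ioo (1 / γ) γ)).measure_lt_top.trans_le' (measure_mono ?_)
  intro z hz
  exact ⟨abs_lt.mp hz.1, hz.2⟩

theorem integrableOn_muHalf_iff {E : Type*} [NormedAddCommGroup E] [NormedSpace ℝ E] {g : ℂ → E}
    {R : Set ℂ} (hR : MeasurableSet R) (hRu : R ⊆ upperHalf) :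
    IntegrableOn g R muHalf ↔ IntegrableOn (fun z => √z.im • g z) R := by
  rw [← integrable_indicator_iff hR, integrable_muHalf_iff]
  have : (fun z : ℂ => √z.im • R.indicator g z) = R.indicator fun z => √z.im • g z := by
    ext z
    by_cases hz : z ∈ R <;> simp [hz]
  rw [this, IntegrableOn, integrable_indicator_iff hR, IntegrableOn, Measure.restrict_restrict hR,
    Set.inter_eq_left.mpr hRu, IntegrableOn]

theorem setIntegral_muHalf {E : Type*} [NormedAddCommGroup E] [NormedSpace ℝ E] (g : ℂ → E)
    {R : Set ℂ} (hR : MeasurableSet R) (hRu : R ⊆ upperHalf) :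
    ∫ z in R, g z ∂muHalf = ∫ z in R, √z.im • g z := by
  rw [← integral_indicator hR, integral_muHalf]
  have : (fun z : ℂ => √z.im • R.indicator g z) = R.indicator fun z => √z.im • g z := by
    ext z
    by_cases hz : z ∈ R <;> simp [hz]
  rw [this, integral_indicator hR, Measure.restrict_restrict hR, Set.inter_eq_left.mpr hRu]

theorem cE_mul_invKernelE (f : ℂ → ℂ) (p : ℝ) (z : ℂ) :
    cE * invKernelE f p z = √z.im • (gaussianKernel z p * f z) := by
  rw [invKernelE, gaussianKernel, Real.sqrt_eq_rpow, Complex.real_smul]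
  ring

theorem invTruncE_eq_integral_muHalf (σ : ℝ) {γ : ℝ} (hγ : 0 < γ) (f : ℂ → ℂ) (p : ℝ) :
    invTruncE σ γ f p = ∫ z in rectE σ γ, gaussianKernel z p * f z ∂muHalf := by
  rw [setIntegral_muHalf _ (measurableSet_rectE σ γ) (rectE_subset_upperHalf σ hγ), invTruncE,
    ← integral_const_mul]
  simp only [cE_mul_invKernelE]

theorem cE_pos : 0 < cE := by unfold cE; positivity

theorem norm_gaussianKernel (z : ℂ) (p : ℝ) :
    ‖gaussianKernel z p‖ = cE * (p ^ 2 * Real.exp (-(z.im / 2) * p ^ 2)) := by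
  rw [gaussianKernel, norm_mul, norm_mul, norm_exp_gaussianKernel, norm_pow, Complex.norm_real,
    Complex.norm_real, Real.norm_of_nonneg cE_pos.le, Real.norm_eq_abs, sq_abs]

/-- One function of `p`, the kernel at height `1/γ`, dominates the whole rectangle. For `γ > 0` it
lies in L², which supplies the L² bound and the Fubini hypothesis. -/
theorem norm_gaussianKernel_le {σ γ : ℝ} {z : ℂ} (hz : z ∈ rectE σ γ) (p : ℝ) :
    ‖gaussianKernel z p‖ ≤ ‖gaussianKernel ((1 / γ : ℝ) * I) p‖ := by
  have := cE_pos
  have h1 := hz.2.1.le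
  rw [norm_gaussianKernel, norm_gaussianKernel]
  have h2 : (((1 / γ : ℝ) : ℂ) * I).im = 1 / γ := by simp
  rw [h2]
  gcongr

instance isFiniteMeasure_muHalf_restrict_rectE (σ γ : ℝ) :
    IsFiniteMeasure (muHalf.restrict (rectE σ γ)) := by
  refine ⟨?_⟩
  rw [Measure.restrict_apply_univ, muHalf, withDensity_apply _ (measurableSet_rectE σ γ)]
  calc _ ≤ ∫⁻ z in rectE σ γ, ENNReal.ofReal (z.im ^ (1 / 2 : ℝ)) :=
        lintegral_mono' (Measure.restrict_mono_measure Measure.restrict_le_self _) le_rfl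
    _ ≤ ∫⁻ z in rectE σ γ, ENNReal.ofReal (√γ) := by
        refine setLIntegral_mono' (measurableSet_rectE σ γ) fun z hz => ?_
        rw [← Real.sqrt_eq_rpow]
        exact ENNReal.ofReal_le_ofReal (Real.sqrt_le_sqrt hz.2.2.le)
    _ < ∞ := by
        rw [setLIntegral_const]
        exact ENNReal.mul_lt_top ENNReal.ofReal_lt_top (volume_rectE_lt_top σ γ)

theorem integrableOn_rectE_of_memLp {f : ℂ → ℂ} (hf : MemLp f 2 muHalf) (σ γ : ℝ) :
    IntegrableOn f (rectE σ γ) muHalf :=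
  (hf.restrict _).integrable (by norm_num)

theorem continuous_uncurry_gaussianKernel :
    Continuous fun q : ℂ × ℝ => gaussianKernel q.1 q.2 := by
  unfold gaussianKernel
  fun_prop

theorem integrableOn_gaussianKernel_mul {f : ℂ → ℂ} (hf : MemLp f 2 muHalf) (σ γ : ℝ) (p : ℝ) :
    IntegrableOn (fun z => gaussianKernel z p * f z) (rectE σ γ) muHalf := by
  refine (integrableOn_rectE_of_memLp hf σ γ).bdd_mul
    (c := ‖gaussianKernel ((1 / γ : ℝ) * I) p‖)
    (continuous_uncurry_gaussianKernel.comp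
      (by fun_prop : Continuous fun z : ℂ => (z, p))).aestronglyMeasurable ?_
  filter_upwards [ae_restrict_mem (measurableSet_rectE σ γ)] with z hz
  exact norm_gaussianKernel_le hz p

theorem integrableOn_invKernelE {f : ℂ → ℂ} (hf : MemLp f 2 muHalf) (σ : ℝ) {γ : ℝ} (hγ : 0 < γ)
    (p : ℝ) : IntegrableOn (invKernelE f p) (rectE σ γ) volume := by
  have h := (integrableOn_muHalf_iff (measurableSet_rectE σ γ) (rectE_subset_upperHalf σ hγ)).mp
    (integrableOn_gaussianKernel_mul hf σ γ p)
  simp only [← cE_mul_invKernelE] at h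
  exact (integrable_const_mul_iff (isUnit_iff_ne_zero.mpr
    (by exact_mod_cast cE_pos.ne')) _).mp h

theorem memLp_gaussianKernel_one_div {γ : ℝ} (hγ : 0 < γ) :
    MemLp (gaussianKernel ((1 / γ : ℝ) * I)) 2 volume := by
  apply memLp_gaussianKernel
  simpa using hγ

theorem memLp_invTruncE {f : ℂ → ℂ} (hf : MemLp f 2 muHalf) (σ : ℝ) {γ : ℝ} (hγ : 0 < γ) :
    MemLp (invTruncE σ γ f) 2 volume := by
  have heq : invTruncE σ γ f = fun p => ∫ z in rectE σ γ, gaussianKernel z p * f z ∂muHalf :=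
    funext (invTruncE_eq_integral_muHalf σ hγ f)
  rw [heq]
  have hm : AEStronglyMeasurable (fun q : ℝ × ℂ => gaussianKernel q.2 q.1 * f q.2)
      (volume.prod (muHalf.restrict (rectE σ γ))) :=
    (continuous_uncurry_gaussianKernel.comp continuous_swap).aestronglyMeasurable.mul
      (hf.1.restrict.comp_snd)
  refine (memLp_gaussianKernel_one_div hγ).of_le_mul (c := ∫ z in rectE σ γ, ‖f z‖ ∂muHalf)
    hm.integral_prod_right' (Eventually.of_forall fun p => ?_)
  refine (norm_integral_le_integral_norm _).trans ?_
  rw [← integral_mul_const]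
  refine integral_mono_ae (integrableOn_gaussianKernel_mul hf σ γ p).norm
    ((integrableOn_rectE_of_memLp hf σ γ).norm.mul_const _) ?_
  filter_upwards [ae_restrict_mem (measurableSet_rectE σ γ)] with z hz
  rw [norm_mul, mul_comm]
  gcongr
  exact norm_gaussianKernel_le hz p

/-- The truncated inverse transform is the adjoint of the transform followed by truncation. -/
theorem integral_conj_mul_transformE {f : ℂ → ℂ} (hf : MemLp f 2 muHalf) {ψ : ℝ → ℂ}
    (hψ : MemLp ψ 2 volume) (σ : ℝ) {γ : ℝ} (hγ : 0 < γ) :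
    ∫ z in rectE σ γ, conj (f z) * transformE ψ z ∂muHalf =
      ∫ p, conj (invTruncE σ γ f p) * ψ p := by
  have hint : Integrable (fun q : ℂ × ℝ => conj (gaussianKernel q.1 q.2 * f q.1) * ψ q.2)
      ((muHalf.restrict (rectE σ γ)).prod volume) := by
    have hb := (integrableOn_rectE_of_memLp hf σ γ).norm.mul_prod
      ((memLp_gaussianKernel_one_div hγ).norm.integrable_mul hψ.norm)
    refine hb.mono' ?_ ?_
    · exact ((Complex.continuous_conj.comp_aestronglyMeasurable
        (continuous_uncurry_gaussianKernel.aestronglyMeasurable.mul hf.1.restrict.comp_fst)).mul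
          hψ.1.comp_snd)
    · filter_upwards [Measure.quasiMeasurePreserving_fst.ae
        (ae_restrict_mem (measurableSet_rectE σ γ))] with q hq
      rw [norm_mul, RCLike.norm_conj, norm_mul, Pi.mul_apply, mul_comm ‖gaussianKernel _ _‖,
        mul_assoc]
      gcongr
      exact norm_gaussianKernel_le hq _
  calc _ = ∫ z in rectE σ γ, (∫ p : ℝ, conj (gaussianKernel z p * f z) * ψ p) ∂muHalf := by
        congr 1
        ext z
        rw [transformE, ← integral_const_mul, ← integral_const_mul]
        congr 1
        ext p
        rw [← conj_gaussianKernel_mul, map_mul]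
        ring
    _ = _ := by
        rw [integral_integral_swap hint]
        congr 1
        ext p
        rw [integral_mul_const, integral_conj, invTruncE_eq_integral_muHalf σ hγ]

theorem eventually_mem_rectE {z : ℂ} (hz : z ∈ upperHalf) :
    ∀ᶠ s : ℝ × ℝ in atTop ×ˢ atTop, z ∈ rectE s.1 s.2 := by
  have hz' : 0 < z.im := hz
  filter_upwards [tendsto_fst.eventually (eventually_gt_atTop |z.re|),
    tendsto_snd.eventually (eventually_gt_atTop z.im),
    tendsto_snd.eventually (eventually_gt_atTop (1 / z.im))] with s h1 h2 h3
  exact ⟨h1, (one_div_lt hz' (hz'.trans h2)).mp h3, h2⟩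

theorem tendsto_eLpNorm_indicator_compl_rectE {f : ℂ → ℂ} (hf : MemLp f 2 muHalf) :
    Tendsto (fun s : ℝ × ℝ => eLpNorm ((rectE s.1 s.2)ᶜ.indicator f) 2 muHalf) (atTop ×ˢ atTop)
      (𝓝 0) := by
  simp_rw [eLpNorm_eq_lintegral_rpow_enorm_toReal (p := 2) two_ne_zero ENNReal.ofNat_ne_top]
  have h0 : (0 : ℝ≥0∞) = 0 ^ (1 / (2 : ℝ≥0∞).toReal) := by
    rw [ENNReal.zero_rpow_of_pos]
    norm_num
  rw [h0]
  refine Tendsto.ennrpow_const _ ?_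
  rw [← lintegral_zero (μ := muHalf)]
  refine tendsto_lintegral_filter_of_dominated_convergence'
    (fun z => ‖f z‖ₑ ^ (2 : ℝ≥0∞).toReal) ?_ ?_ ?_ ?_
  · exact Eventually.of_forall fun s =>
      ((hf.1.indicator (measurableSet_rectE _ _).compl).enorm).pow_const _
  · refine Eventually.of_forall fun s => Eventually.of_forall fun z => ?_
    gcongr
    exact enorm_indicator_le_enorm_self _ _
  · exact (lintegral_rpow_enorm_lt_top_of_eLpNorm_lt_top two_ne_zero ENNReal.ofNat_ne_top hf.2).ne
  · filter_upwards [ae_mem_upperHalf] with z hz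
    refine tendsto_const_nhds.congr' ?_
    filter_upwards [eventually_mem_rectE hz] with s hs
    rw [Set.indicator_of_notMem (Set.notMem_compl_iff.mpr hs), enorm_zero, ENNReal.zero_rpow_of_pos]
    norm_num

theorem invTruncE_neg (σ γ : ℝ) (f : ℂ → ℂ) (p : ℝ) :
    invTruncE σ γ f (-p) = invTruncE σ γ f p := by
  simp [invTruncE, invKernelE]

/-- The truncated inverse transform, as an even element of `L²`. -/
def invTruncLp (F : Lp ℂ 2 muHalf) (σ : ℝ) {γ : ℝ} (hγ : 0 < γ) : evenL2 :=
  ⟨(memLp_invTruncE (Lp.memLp F) σ hγ).toLp _, by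
    have h := (memLp_invTruncE (Lp.memLp F) σ hγ).coeFn_toLp
    have h' := (Measure.measurePreserving_neg (volume : Measure ℝ)).quasiMeasurePreserving.ae h
    change _ =ᵐ[volume] _
    filter_upwards [h, h'] with p h1 h2
    rw [h1, h2, invTruncE_neg]⟩

/-- Truncated inversion is `U*` after cutting off to the rectangle, so the error is `-U*` of the
part of `F` outside it. -/
theorem enorm_invTruncLp_sub_le {U : evenL2 ≃ₗᵢ[ℂ] bergmanHalf}
    (hU : ∀ ψ : evenL2,
      (U ψ : Lp ℂ 2 muHalf) =ᵐ[muHalf] transformE (ψ : Lp ℂ 2 (volume : Measure ℝ)))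
    (F : bergmanHalf) (σ : ℝ) {γ : ℝ} (hγ : 0 < γ) :
    ‖invTruncLp F σ hγ - U.symm F‖ₑ ≤
      eLpNorm ((rectE σ γ)ᶜ.indicator (F : Lp ℂ 2 muHalf)) 2 muHalf := by
  have hF := Lp.memLp (F : Lp ℂ 2 muHalf)
  have hm := (measurableSet_rectE σ γ)
  set G : Lp ℂ 2 muHalf := (hF.indicator hm.compl).toLp _ with hG
  have hGn : ‖G‖ₑ = eLpNorm ((rectE σ γ)ᶜ.indicator (F : Lp ℂ 2 muHalf)) 2 muHalf :=
    Lp.enorm_toLp _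
  have hinner : ∀ ψ : evenL2, inner ℂ (invTruncLp F σ hγ - U.symm F) ψ =
      -inner ℂ G (U ψ : Lp ℂ 2 muHalf) := by
    intro ψ
    have h1 : inner ℂ (U.symm F) ψ = inner ℂ (F : Lp ℂ 2 muHalf) (U ψ : Lp ℂ 2 muHalf) := by
      rw [← LinearIsometryEquiv.inner_map_map U, U.apply_symm_apply]
      rfl
    have h2 : inner ℂ (invTruncLp F σ hγ) ψ =
        ∫ z in rectE σ γ, inner ℂ ((F : Lp ℂ 2 muHalf) z) ((U ψ : Lp ℂ 2 muHalf) z) ∂muHalf := by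
      change inner ℂ (invTruncLp F σ hγ : Lp ℂ 2 (volume : Measure ℝ)) ψ = _
      have h3 : ∫ z in rectE σ γ, inner ℂ ((F : Lp ℂ 2 muHalf) z) ((U ψ : Lp ℂ 2 muHalf) z)
          ∂muHalf = ∫ z in rectE σ γ, conj ((F : Lp ℂ 2 muHalf) z) *
            transformE (ψ : Lp ℂ 2 (volume : Measure ℝ)) z ∂muHalf := by
        apply integral_congr_ae
        filter_upwards [ae_restrict_of_ae (hU ψ)] with z hz
        rw [hz, RCLike.inner_apply, mul_comm]
      rw [h3, integral_conj_mul_transformE hF (Lp.memLp _) σ hγ, L2.inner_def]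
      apply integral_congr_ae
      filter_upwards [(memLp_invTruncE hF σ hγ).coeFn_toLp] with p hp
      rw [invTruncLp, hp, RCLike.inner_apply, mul_comm]
    have h4 : inner ℂ G (U ψ : Lp ℂ 2 muHalf) = ∫ z in (rectE σ γ)ᶜ,
        inner ℂ ((F : Lp ℂ 2 muHalf) z) ((U ψ : Lp ℂ 2 muHalf) z) ∂muHalf := by
      rw [L2.inner_def, ← integral_indicator hm.compl]
      apply integral_congr_ae
      filter_upwards [(hF.indicator hm.compl).coeFn_toLp] with z hz
      rw [hG, hz]
      by_cases h : z ∈ (rectE σ γ)ᶜ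
      · rw [Set.indicator_of_mem h, Set.indicator_of_mem h]
      · rw [Set.indicator_of_notMem h, Set.indicator_of_notMem h, inner_zero_left]
    rw [inner_sub_left, h1, h2, h4, L2.inner_def,
      ← integral_add_compl hm (L2.integrable_inner (𝕜 := ℂ) _ _)]
    ring
  rw [← hGn, enorm_le_iff_norm_le]
  set d := invTruncLp F σ hγ - U.symm F
  -- Duality: the error `d` is tested against itself, then Cauchy–Schwarz.
  have h1 : ‖d‖ * ‖d‖ ≤ ‖G‖ * ‖d‖ := by
    have h2 : ‖d‖ * ‖d‖ = ‖inner ℂ d d‖ := by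
      rw [inner_self_eq_norm_sq_to_K (𝕜 := ℂ) d, norm_pow]
      simp [pow_two]
    have h3 : ‖(U d : Lp ℂ 2 muHalf)‖ = ‖d‖ := U.norm_map d
    rw [h2, hinner d, norm_neg, ← h3]
    exact norm_inner_le_norm _ _
  by_cases h0 : ‖d‖ = 0
  · rw [h0]
    exact norm_nonneg _
  · exact le_of_mul_le_mul_right h1 (lt_of_le_of_ne (norm_nonneg d) (Ne.symm h0))

theorem tendsto_eLpNorm_invTruncE_sub {U : evenL2 ≃ₗᵢ[ℂ] bergmanHalf}
    (hU : ∀ ψ : evenL2,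
      (U ψ : Lp ℂ 2 muHalf) =ᵐ[muHalf] transformE (ψ : Lp ℂ 2 (volume : Measure ℝ)))
    (F : bergmanHalf) :
    Tendsto (fun s : ℝ × ℝ => eLpNorm
      (fun p : ℝ => invTruncE s.1 s.2 ((F : Lp ℂ 2 muHalf) : ℂ → ℂ) p -
        ((U.symm F : Lp ℂ 2 (volume : Measure ℝ)) : ℝ → ℂ) p) 2 volume)
      (atTop ×ˢ atTop) (𝓝 0) := by
  refine tendsto_of_tendsto_of_tendsto_of_le_of_le' tendsto_const_nhds
    (tendsto_eLpNorm_indicator_compl_rectE (Lp.memLp (F : Lp ℂ 2 muHalf)))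
    (Eventually.of_forall fun _ => zero_le) ?_
  filter_upwards [tendsto_snd.eventually (eventually_gt_atTop (0 : ℝ))] with s hs
  refine le_trans (le_of_eq ?_) (enorm_invTruncLp_sub_le hU F s.1 hs)
  change _ = ‖(invTruncLp F s.1 hs : Lp ℂ 2 (volume : Measure ℝ)) - U.symm F‖ₑ
  rw [Lp.enorm_def]
  apply eLpNorm_congr_ae
  filter_upwards [Lp.coeFn_sub (invTruncLp F s.1 hs : Lp ℂ 2 (volume : Measure ℝ)) (U.symm F),
    (memLp_invTruncE (Lp.memLp (F : Lp ℂ 2 muHalf)) s.1 hs).coeFn_toLp] with p h1 h2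
  rw [h1, Pi.sub_apply, invTruncLp, h2]

/-! ### Decay of the transform of a Schwartz function -/

theorem norm_exp_neg_sub_one_le {w : ℂ} (hw : 0 ≤ w.re) : ‖cexp (-w) - 1‖ ≤ 2 * ‖w‖ := by
  rcases le_or_gt ‖w‖ 1 with h | h
  · simpa using Complex.norm_exp_sub_one_le (x := -w) (by simpa using h)
  · calc ‖cexp (-w) - 1‖ ≤ ‖cexp (-w)‖ + ‖(1 : ℂ)‖ := norm_sub_le _ _
      _ ≤ 1 + 1 := by
        gcongr
        · rw [Complex.norm_exp]
          simpa using hw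
        · simp
      _ ≤ 2 * ‖w‖ := by linarith

-- Moving the Fourier transform onto the Gaussian gives `b^(-1/2) exp(-π ξ²/b)`. As `η` has integral
-- zero, 1 may be subtracted from the exponential, gaining a further `|b|⁻¹`. Squaring the resulting
-- `|b|^(-3/2)` bound keeps the powers integral.
open FourierTransform in
theorem norm_integral_fourier_mul_gaussian_sq_le (η : 𝓢(ℝ, ℂ)) (hη : 𝓕 η 0 = 0) {b : ℂ}
    (hb : 0 < b.re) :
    ‖∫ p : ℝ, 𝓕 η p * cexp (-Real.pi * b * p ^ 2)‖ ^ 2 * ‖b‖ ^ 3 ≤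
      (2 * Real.pi * ∫ ξ, ‖ξ‖ ^ 2 * ‖η ξ‖) ^ 2 := by
  have hb0 : b ≠ 0 := by rintro rfl; simp at hb
  have hbn : 0 < ‖b‖ := norm_pos_iff.mpr hb0
  have hg : Integrable fun p : ℝ => cexp (-Real.pi * b * p ^ 2) := by
    have := integrable_pow_mul_cexp_neg_mul_sq 0 (r := Real.pi * b) (by
      simpa using mul_pos Real.pi_pos hb)
    simpa using this
  have hinv : 0 ≤ (Real.pi / b).re := by
    rw [Complex.div_re]
    simpa using div_nonneg (mul_nonneg Real.pi_pos.le hb.le) (Complex.normSq_nonneg b)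
  have hg1 : ∀ ξ : ℝ, ‖cexp (-Real.pi / b * ξ ^ 2)‖ ≤ 1 := by
    intro ξ
    rw [Complex.norm_exp]
    simp only [neg_div, neg_mul, ← Complex.ofReal_pow, Complex.neg_re, Complex.re_mul_ofReal]
    rw [Real.exp_le_one_iff, neg_nonpos]
    positivity
  have hint : Integrable fun ξ : ℝ => η ξ * cexp (-Real.pi / b * ξ ^ 2) := by
    refine η.integrable.mul_bdd (c := 1) (by fun_prop) (Eventually.of_forall hg1)
  have key := VectorFourier.integral_fourierIntegral_smul_eq_flip (L := innerₗ ℝ)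
    (μ := volume) (ν := volume) Real.continuous_fourierChar continuous_inner η.integrable hg
  have h1 : ∀ p, VectorFourier.fourierIntegral Real.fourierChar volume (innerₗ ℝ) η p = 𝓕 η p :=
    fun _ => rfl
  have h2 : ∀ ξ : ℝ, VectorFourier.fourierIntegral Real.fourierChar volume (innerₗ ℝ).flip
      (fun p : ℝ => cexp (-Real.pi * b * p ^ 2)) ξ =
        1 / b ^ (1 / 2 : ℂ) * cexp (-Real.pi / b * ξ ^ 2) := by
    intro ξ
    rw [flip_innerₗ]
    exact congrFun (fourier_gaussian_pi hb) ξ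
  simp only [h1, h2, smul_eq_mul] at key
  have hη0 : ∫ ξ, η ξ = 0 := by
    rw [← hη, SchwartzMap.fourier_coe, Real.fourier_real_eq]
    simp
  have key2 : ∫ p : ℝ, 𝓕 η p * cexp (-Real.pi * b * p ^ 2) =
      1 / b ^ (1 / 2 : ℂ) * ∫ ξ : ℝ, η ξ * (cexp (-Real.pi / b * ξ ^ 2) - 1) := by
    rw [key]
    simp only [mul_sub, mul_one, mul_left_comm (η _)]
    rw [integral_sub hint η.integrable, hη0, sub_zero, integral_const_mul]
  have hbound : ‖∫ ξ : ℝ, η ξ * (cexp (-Real.pi / b * ξ ^ 2) - 1)‖ ≤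
      (2 * Real.pi * ∫ ξ, ‖ξ‖ ^ 2 * ‖η ξ‖) / ‖b‖ := by
    rw [mul_div_right_comm, ← integral_const_mul]
    refine norm_integral_le_of_norm_le ((η.integrable_pow_mul volume 2).const_mul _)
      (Eventually.of_forall fun ξ => ?_)
    have h3 := norm_exp_neg_sub_one_le (w := Real.pi / b * ξ ^ 2) (by
      rw [← Complex.ofReal_pow, Complex.re_mul_ofReal]
      positivity)
    rw [show -(Real.pi / b * (ξ : ℂ) ^ 2) = -Real.pi / b * ξ ^ 2 by ring] at h3
    rw [norm_mul]
    calc _ ≤ ‖η ξ‖ * (2 * ‖(Real.pi / b * ξ ^ 2 : ℂ)‖) := by gcongr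
      _ = _ := by
        rw [norm_mul, norm_div, norm_pow, Complex.norm_real, Complex.norm_real,
          Real.norm_of_nonneg Real.pi_pos.le]
        ring
  have hroot : ‖b ^ (1 / 2 : ℂ)‖ ^ 2 = ‖b‖ := by rw [← norm_pow, cpow_half_sq]
  rw [key2, norm_mul, mul_pow, norm_div, norm_one, div_pow, one_pow, hroot]
  calc _ ≤ 1 / ‖b‖ * ((2 * Real.pi * ∫ ξ, ‖ξ‖ ^ 2 * ‖η ξ‖) / ‖b‖) ^ 2 * ‖b‖ ^ 3 := by gcongr
    _ = _ := by field_simp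

-- The amplitude `p²ψ(p)` vanishes at 0, so the preceding bound applies with `b = -iz/(2π)`; it is
-- uniform up to the real axis.
open FourierTransform in
theorem exists_norm_transformE_sq_mul_le (ψ : 𝓢(ℝ, ℂ)) :
    ∃ K : ℝ, ∀ z ∈ upperHalf, ‖transformE ψ z‖ ^ 2 * ‖z‖ ^ 3 ≤ K := by
  have hgrowth : (fun p : ℝ => (p : ℂ) ^ 2).HasTemperateGrowth := by fun_prop
  set φ : 𝓢(ℝ, ℂ) := SchwartzMap.smulLeftCLM ℂ (fun p : ℝ => (p : ℂ) ^ 2) ψ with hφ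
  have hφp : ∀ p, φ p = (p : ℂ) ^ 2 * ψ p := fun p => by
    rw [hφ, SchwartzMap.smulLeftCLM_apply_apply hgrowth, smul_eq_mul]
  set η : 𝓢(ℝ, ℂ) := 𝓕⁻ φ with hη
  have hηφ : 𝓕 η = φ := FourierTransform.fourier_fourierInv_eq φ
  refine ⟨cE ^ 2 * (2 * Real.pi) ^ 3 * (2 * Real.pi * ∫ ξ, ‖ξ‖ ^ 2 * ‖η ξ‖) ^ 2, fun z hz => ?_⟩
  have hz' : 0 < z.im := hz
  have hpi : (Real.pi : ℂ) ≠ 0 := by exact_mod_cast Real.pi_ne_zero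
  set b : ℂ := -(I * z) / (2 * Real.pi : ℝ) with hb
  have hbre : 0 < b.re := by
    rw [hb, Complex.div_ofReal_re]
    have : (-(I * z)).re = z.im := by simp
    rw [this]
    positivity
  have h := norm_integral_fourier_mul_gaussian_sq_le η (by rw [hηφ, hφp]; simp) hbre
  have hT : transformE ψ z = cE * ∫ p : ℝ, 𝓕 η p * cexp (-Real.pi * b * p ^ 2) := by
    rw [transformE, hηφ]
    congr 2
    ext p
    rw [kernelE, hφp, hb]
    have : -(Real.pi : ℂ) * (-(I * z) / (2 * Real.pi : ℝ)) * (p : ℂ) ^ 2 = I * z * p ^ 2 / 2 := by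
      push_cast
      field_simp
    rw [this]
    ring
  have hzb : ‖z‖ = 2 * Real.pi * ‖b‖ := by
    rw [hb, norm_div, norm_neg, norm_mul, Complex.norm_I, Complex.norm_real,
      Real.norm_of_nonneg (by positivity)]
    field_simp
  rw [hT, norm_mul, hzb, Complex.norm_real, Real.norm_of_nonneg cE_pos.le]
  calc _ = cE ^ 2 * (2 * Real.pi) ^ 3 *
        (‖∫ p : ℝ, 𝓕 η p * cexp (-Real.pi * b * p ^ 2)‖ ^ 2 * ‖b‖ ^ 3) := by ring
    _ ≤ _ := by gcongr

theorem exists_norm_transformE_le (ψ : 𝓢(ℝ, ℂ)) :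
    ∃ K : ℝ, ∀ z ∈ upperHalf, ‖transformE ψ z‖ ≤ K := by
  refine ⟨cE * ∫ p, ‖p‖ ^ 2 * ‖ψ p‖, fun z hz => ?_⟩
  have hz' : 0 < z.im := hz
  rw [transformE, norm_mul, Complex.norm_real, Real.norm_of_nonneg cE_pos.le]
  have := cE_pos
  gcongr
  refine norm_integral_le_of_norm_le (ψ.integrable_pow_mul volume 2)
    (Eventually.of_forall fun p => ?_)
  rw [kernelE, norm_mul, norm_mul, norm_pow, Complex.norm_real]
  have : ‖cexp (I * z * (p : ℂ) ^ 2 / 2)‖ ≤ 1 := by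
    rw [Complex.norm_exp, Real.exp_le_one_iff]
    simp only [← Complex.ofReal_pow, Complex.div_ofNat_re, Complex.re_mul_ofReal, Complex.I_mul_re]
    have : 0 ≤ z.im * p ^ 2 := by positivity
    linarith
  calc _ ≤ ‖p‖ ^ 2 * 1 * ‖ψ p‖ := by gcongr
    _ = _ := by ring

/-- Combines boundedness near the origin with decay at infinity. The order 3/2 in `Re z` exceeds 1,
hence is integrable along horizontal lines. -/
theorem exists_norm_transformE_le_rpow (ψ : 𝓢(ℝ, ℂ)) :
    ∃ K : ℝ, 0 ≤ K ∧
      ∀ z ∈ upperHalf, ‖transformE ψ z‖ ≤ K * (1 + ‖z.re‖ ^ 2) ^ (-(3 / 2 : ℝ) / 2) := by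
  obtain ⟨K₁, h1⟩ := exists_norm_transformE_le ψ
  obtain ⟨K₂, h2⟩ := exists_norm_transformE_sq_mul_le ψ
  -- The 8 comes from `(1 + y)³ ≤ 8 (1 + y³)` with `y = (Re z)²`.
  set M := 8 * (K₁ ^ 4 + K₂ ^ 2) with hM
  refine ⟨M ^ (1 / 4 : ℝ), by positivity, fun z hz => ?_⟩
  set T := ‖transformE ψ z‖ with hT
  have hT0 : 0 ≤ T := norm_nonneg _
  have hx : 0 ≤ ‖z.re‖ := norm_nonneg _
  have hxz : ‖z.re‖ ≤ ‖z‖ := Complex.abs_re_le_norm z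
  have hmain : T ^ 4 * (1 + ‖z.re‖ ^ 2) ^ 3 ≤ M := by
    have e1 : T ^ 4 ≤ K₁ ^ 4 := by
      have := h1 z hz
      gcongr
    have e2 : T ^ 4 * ‖z.re‖ ^ 6 ≤ K₂ ^ 2 := by
      calc T ^ 4 * ‖z.re‖ ^ 6 ≤ T ^ 4 * ‖z‖ ^ 6 := by gcongr
        _ = (T ^ 2 * ‖z‖ ^ 3) ^ 2 := by ring
        _ ≤ K₂ ^ 2 := by
          have := h2 z hz
          gcongr
    have e3 : (1 + ‖z.re‖ ^ 2) ^ 3 ≤ 8 * (1 + ‖z.re‖ ^ 6) := by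
      have hy : 0 ≤ ‖z.re‖ ^ 2 := by positivity
      rw [show ‖z.re‖ ^ 6 = (‖z.re‖ ^ 2) ^ 3 by ring]
      generalize ‖z.re‖ ^ 2 = y at hy
      nlinarith [mul_nonneg hy (sq_nonneg (y - 1)), sq_nonneg (y - 1),
        mul_nonneg (by linarith : 0 ≤ y + 1) (sq_nonneg (y - 1))]
    calc _ ≤ T ^ 4 * (8 * (1 + ‖z.re‖ ^ 6)) := by gcongr
      _ = 8 * (T ^ 4 + T ^ 4 * ‖z.re‖ ^ 6) := by ring
      _ ≤ _ := by rw [hM]; gcongr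
  have hB : 0 < 1 + ‖z.re‖ ^ 2 := by positivity
  have h4 : T ^ 4 ≤ M * (1 + ‖z.re‖ ^ 2) ^ (-3 : ℝ) := by
    rw [Real.rpow_neg hB.le, ← div_eq_mul_inv, le_div_iff₀ (by positivity)]
    exact_mod_cast hmain
  calc T = (T ^ 4) ^ (1 / 4 : ℝ) := by
        rw [← Real.rpow_natCast, ← Real.rpow_mul hT0]
        norm_num
    _ ≤ (M * (1 + ‖z.re‖ ^ 2) ^ (-3 : ℝ)) ^ (1 / 4 : ℝ) := by gcongr
    _ = _ := by
        rw [Real.mul_rpow (by positivity) (by positivity), ← Real.rpow_mul hB.le]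
        norm_num

/-! ### Pointwise inversion -/

theorem integrable_decay_muHalf {δ : ℝ} (hδ : 0 < δ) :
    Integrable (fun z : ℂ => (1 + ‖z.re‖ ^ 2) ^ (-(3 / 2 : ℝ) / 2) * Real.exp (-δ * z.im))
      muHalf := by
  rw [integrable_muHalf_iff]
  have h1 : IntegrableOn (fun b : ℝ => (1 + ‖b‖ ^ 2) ^ (-(3 / 2 : ℝ) / 2)) Set.univ :=
    integrableOn_univ.mpr (integrable_rpow_neg_one_add_norm_sq (by norm_num))
  have h2 : IntegrableOn (fun a : ℝ => √a * Real.exp (-δ * a)) (Set.Ioi 0) := by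
    have := integrableOn_rpow_mul_exp_neg_mul_rpow (p := 1) (s := 1 / 2) (by norm_num)
      (by norm_num) hδ
    simpa only [Real.rpow_one, ← Real.sqrt_eq_rpow] using this
  have h3 := Integrable.mul_prod h1 h2
  rw [Measure.prod_restrict] at h3
  have h4 := (Complex.volume_preserving_equiv_real_prod.integrableOn_comp_preimage
    Complex.measurableEquivRealProd.measurableEmbedding).mpr h3
  have hset : Complex.measurableEquivRealProd ⁻¹' (Set.univ ×ˢ Set.Ioi 0) = upperHalf := by
    ext z
    simp [upperHalf]
  rw [hset] at h4
  refine h4.congr (Eventually.of_forall fun z => ?_)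
  simp only [Function.comp_apply, Complex.measurableEquivRealProd_apply, smul_eq_mul]
  ring

theorem norm_gaussianKernel_mul_transformE_le {ψ : 𝓢(ℝ, ℂ)} {K : ℝ}
    (hK : ∀ z ∈ upperHalf, ‖transformE ψ z‖ ≤ K * (1 + ‖z.re‖ ^ 2) ^ (-(3 / 2 : ℝ) / 2))
    {δ m : ℝ} {p : ℝ} (hδ : 2 * δ ≤ p ^ 2) (hm : p ^ 2 ≤ m) {z : ℂ} (hz : z ∈ upperHalf) :
    ‖gaussianKernel z p * transformE ψ z‖ ≤
      cE * m * K * ((1 + ‖z.re‖ ^ 2) ^ (-(3 / 2 : ℝ) / 2) * Real.exp (-δ * z.im)) := by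
  have hz' : 0 < z.im := hz
  have hc := cE_pos
  have hm0 : 0 ≤ m := (sq_nonneg p).trans hm
  have hexp : Real.exp (-(z.im / 2) * p ^ 2) ≤ Real.exp (-δ * z.im) := by
    apply Real.exp_le_exp.mpr
    nlinarith
  rw [norm_mul, norm_gaussianKernel]
  calc _ ≤ cE * (m * Real.exp (-δ * z.im)) * (K * (1 + ‖z.re‖ ^ 2) ^ (-(3 / 2 : ℝ) / 2)) := by
        gcongr
        exact hK z hz
    _ = _ := by ring

theorem aestronglyMeasurable_of_differentiableOn_upperHalf {f : ℂ → ℂ}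
    (hf : DifferentiableOn ℂ f upperHalf) : AEStronglyMeasurable f muHalf :=
  (hf.continuousOn.aestronglyMeasurable measurableSet_upperHalf).mono_ac
    muHalf_absolutelyContinuous

theorem aestronglyMeasurable_gaussianKernel_mul {f : ℂ → ℂ} (hf : AEStronglyMeasurable f muHalf)
    (p : ℝ) : AEStronglyMeasurable (fun z => gaussianKernel z p * f z) muHalf :=
  (continuous_uncurry_gaussianKernel.comp
    (by fun_prop : Continuous fun z : ℂ => (z, p))).aestronglyMeasurable.mul hf

theorem integrable_gaussianKernel_mul_transformE {ψ : 𝓢(ℝ, ℂ)}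
    (hψ : DifferentiableOn ℂ (transformE ψ) upperHalf) {p : ℝ} (hp : p ≠ 0) :
    Integrable (fun z => gaussianKernel z p * transformE ψ z) muHalf := by
  obtain ⟨K, -, hK⟩ := exists_norm_transformE_le_rpow ψ
  have hp2 : 0 < p ^ 2 / 2 := by positivity
  refine ((integrable_decay_muHalf hp2).const_mul (cE * p ^ 2 * K)).mono'
    (aestronglyMeasurable_gaussianKernel_mul
      (aestronglyMeasurable_of_differentiableOn_upperHalf hψ) p) ?_
  filter_upwards [ae_mem_upperHalf] with z hz
  exact norm_gaussianKernel_mul_transformE_le hK (by linarith) le_rfl hz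

theorem tendsto_invTruncE_transformE {ψ : 𝓢(ℝ, ℂ)}
    (hψ : DifferentiableOn ℂ (transformE ψ) upperHalf) {p : ℝ} (hp : p ≠ 0) :
    Tendsto (fun s : ℝ × ℝ => invTruncE s.1 s.2 (transformE ψ) p) (atTop ×ˢ atTop)
      (𝓝 (∫ z, gaussianKernel z p * transformE ψ z ∂muHalf)) := by
  have hi := integrable_gaussianKernel_mul_transformE hψ hp
  have heq : (fun s : ℝ × ℝ => ∫ z, (rectE s.1 s.2).indicator
      (fun z => gaussianKernel z p * transformE ψ z) z ∂muHalf) =ᶠ[atTop ×ˢ atTop]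
      fun s => invTruncE s.1 s.2 (transformE ψ) p := by
    filter_upwards [tendsto_snd.eventually (eventually_gt_atTop (0 : ℝ))] with s hs
    rw [invTruncE_eq_integral_muHalf _ hs, integral_indicator (measurableSet_rectE _ _)]
  refine Tendsto.congr' heq ?_
  refine tendsto_integral_filter_of_dominated_convergence _
    (Eventually.of_forall fun s => hi.1.indicator (measurableSet_rectE _ _))
    (Eventually.of_forall fun s => Eventually.of_forall fun z => norm_indicator_le_norm_self _ _)
    hi.norm ?_
  filter_upwards [ae_mem_upperHalf] with z hz
  refine tendsto_const_nhds.congr' ?_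
  filter_upwards [eventually_mem_rectE hz] with s hs
  rw [Set.indicator_of_mem hs]

/-- Near `p ≠ 0`, `q²` stays between `p²/2` and `p² + 1`, which gives one integrable majorant. At 0
the exponential decay in height is lost, and the integrand vanishes whatever `ψ(0)` is. -/
theorem continuousOn_integral_gaussianKernel_mul {ψ : 𝓢(ℝ, ℂ)}
    (hψ : DifferentiableOn ℂ (transformE ψ) upperHalf) :
    ContinuousOn (fun p : ℝ => ∫ z, gaussianKernel z p * transformE ψ z ∂muHalf) {0}ᶜ := by
  obtain ⟨K, -, hK⟩ := exists_norm_transformE_le_rpow ψ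
  intro p hp
  have hp2 : 0 < p ^ 2 := by
    have : p ≠ 0 := hp
    positivity
  have hp4 : 0 < p ^ 2 / 4 := by positivity
  apply ContinuousAt.continuousWithinAt
  have hm : ∀ q, AEStronglyMeasurable (fun z => gaussianKernel z q * transformE ψ z) muHalf :=
    aestronglyMeasurable_gaussianKernel_mul (aestronglyMeasurable_of_differentiableOn_upperHalf hψ)
  refine continuousAt_of_dominated (F := fun q z => gaussianKernel z q * transformE ψ z)
    (bound := fun z => cE * (p ^ 2 + 1) * K *
      ((1 + ‖z.re‖ ^ 2) ^ (-(3 / 2 : ℝ) / 2) * Real.exp (-(p ^ 2 / 4) * z.im)))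
    (Eventually.of_forall hm) ?_ ((integrable_decay_muHalf hp4).const_mul _) ?_
  · have hc : Tendsto (fun q : ℝ => q ^ 2) (𝓝 p) (𝓝 (p ^ 2)) :=
      (continuous_pow 2).continuousAt.tendsto
    filter_upwards [hc.eventually_const_lt (show p ^ 2 / 2 < p ^ 2 by linarith),
      hc.eventually_lt_const (show p ^ 2 < p ^ 2 + 1 by linarith)] with q h1 h2
    filter_upwards [ae_mem_upperHalf] with z hz
    exact norm_gaussianKernel_mul_transformE_le hK (by linarith) h2.le hz
  · refine Eventually.of_forall fun z => ?_
    have hk := continuous_gaussianKernel z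
    exact (hk.mul_const _).continuousAt

/-- Dominated convergence gives a limit at each `p ≠ 0`, and the L² limit only identifies it almost
everywhere. Continuity of both sides off 0 removes the exceptional set. -/
theorem tendsto_invTruncE_pointwise {U : evenL2 ≃ₗᵢ[ℂ] bergmanHalf}
    (hU : ∀ ψ : evenL2,
      (U ψ : Lp ℂ 2 muHalf) =ᵐ[muHalf] transformE (ψ : Lp ℂ 2 (volume : Measure ℝ)))
    {ψ : evenSchwartz} (hψ : DifferentiableOn ℂ (transformE (ψ : 𝓢(ℝ, ℂ))) upperHalf)
    {p : ℝ} (hp : p ≠ 0) :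
    Tendsto (fun s : ℝ × ℝ => invTruncE s.1 s.2 (transformE (ψ : 𝓢(ℝ, ℂ))) p)
      (atTop ×ˢ atTop) (𝓝 ((ψ : 𝓢(ℝ, ℂ)) p)) := by
  set F : bergmanHalf := U (evenSchwartzToL2 ψ) with hF
  have hFψ : (F : Lp ℂ 2 muHalf) =ᵐ[muHalf] transformE (ψ : 𝓢(ℝ, ℂ)) := by
    rw [← transformE_evenSchwartzToL2]
    exact hU _
  -- A diagonal sequence is enough to extract an almost everywhere convergent subsequence; `n + 1`
  -- keeps `γ` positive.
  have hseq : Tendsto (fun n : ℕ => ((n + 1 : ℝ), (n + 1 : ℝ))) atTop (atTop ×ˢ atTop) :=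
    (tendsto_atTop_add_const_right _ _ tendsto_natCast_atTop_atTop).prodMk
      (tendsto_atTop_add_const_right _ _ tendsto_natCast_atTop_atTop)
  have hL2 := (tendsto_eLpNorm_invTruncE_sub hU F).comp hseq
  rw [hF, U.symm_apply_apply, ← hF] at hL2
  have hmeas := tendstoInMeasure_of_tendsto_eLpNorm (p := 2) two_ne_zero
    (fun n : ℕ => (memLp_invTruncE (Lp.memLp (F : Lp ℂ 2 muHalf)) (n + 1 : ℝ)
      (by positivity : (0 : ℝ) < n + 1)).1) (Lp.aestronglyMeasurable _) hL2
  obtain ⟨ns, hns, hae⟩ := hmeas.exists_seq_tendsto_ae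
  have hcongr : ∀ (n : ℕ) (q : ℝ), invTruncE (n + 1) (n + 1) ((F : Lp ℂ 2 muHalf) : ℂ → ℂ) q =
      invTruncE (n + 1) (n + 1) (transformE (ψ : 𝓢(ℝ, ℂ))) q := by
    intro n q
    have hn : (0 : ℝ) < n + 1 := by positivity
    rw [invTruncE_eq_integral_muHalf _ hn, invTruncE_eq_integral_muHalf _ hn]
    apply integral_congr_ae
    filter_upwards [ae_restrict_of_ae hFψ] with z hz
    rw [hz]
  have hlim : (fun q : ℝ => ∫ z, gaussianKernel z q * transformE (ψ : 𝓢(ℝ, ℂ)) z ∂muHalf)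
      =ᵐ[volume] (ψ : 𝓢(ℝ, ℂ)) := by
    filter_upwards [hae, (ψ : 𝓢(ℝ, ℂ)).coeFn_toLp 2 volume, Measure.ae_ne volume (0 : ℝ)]
      with q h1 h2 h3
    rw [← h2]
    have h4 : Tendsto (fun i => invTruncE (ns i + 1) (ns i + 1) ((F : Lp ℂ 2 muHalf) : ℂ → ℂ) q)
        atTop (𝓝 ((evenSchwartzToL2 ψ : Lp ℂ 2 (volume : Measure ℝ)) q)) := h1
    have h5 := (tendsto_invTruncE_transformE hψ h3).comp (hseq.comp hns.tendsto_atTop)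
    have h6 : (fun s : ℝ × ℝ => invTruncE s.1 s.2 (transformE (ψ : 𝓢(ℝ, ℂ))) q) ∘
        (fun n : ℕ => ((n + 1 : ℝ), (n + 1 : ℝ))) ∘ ns =
        fun i => invTruncE (ns i + 1) (ns i + 1) (transformE (ψ : 𝓢(ℝ, ℂ))) q := by
      ext i
      simp only [Function.comp_apply]
    rw [h6] at h5
    simp only [hcongr] at h4
    exact tendsto_nhds_unique h5 h4
  have heq : _ = (ψ : 𝓢(ℝ, ℂ)) p := Measure.eqOn_open_of_ae_eq
    (ae_restrict_of_ae hlim) isOpen_compl_singleton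
    (continuousOn_integral_gaussianKernel_mul hψ) (ψ : 𝓢(ℝ, ℂ)).continuous.continuousOn hp
  rw [← heq]
  exact tendsto_invTruncE_transformE hψ hp

end

/-! ### The main theorem -/

theorem mainTheorem2 :
    -- the transform is well defined on even Schwartz functions, with values in the Bergman space
    (∀ ψ : evenSchwartz,
      (∀ z ∈ upperHalf, Integrable (kernelE (ψ : 𝓢(ℝ, ℂ)) z) volume) ∧
      DifferentiableOn ℂ (transformE (ψ : 𝓢(ℝ, ℂ))) upperHalf ∧
      MemLp (transformE (ψ : 𝓢(ℝ, ℂ))) 2 muHalf) ∧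
    -- it preserves inner products
    (∀ φ ψ : evenSchwartz,
      ∫ z, transformE (φ : 𝓢(ℝ, ℂ)) z * conj (transformE (ψ : 𝓢(ℝ, ℂ)) z) ∂muHalf =
        ∫ p : ℝ, (φ : 𝓢(ℝ, ℂ)) p * conj ((ψ : 𝓢(ℝ, ℂ)) p)) ∧
    -- even Schwartz functions are dense in the even part of `L²(ℝ)`
    DenseRange evenSchwartzToL2 ∧
    -- the transform extends to a unitary map onto the Bergman space
    (∃ U : evenL2 ≃ₗᵢ[ℂ] bergmanHalf,
      (∀ ψ : evenSchwartz,
        ((U (evenSchwartzToL2 ψ) : Lp ℂ 2 muHalf) : ℂ → ℂ) =ᵐ[muHalf]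
          transformE (ψ : 𝓢(ℝ, ℂ))) ∧
      -- inversion on the whole Bergman space, the limit being taken in `L²(ℝ)`
      (∀ F : bergmanHalf,
        (∀ σ γ : ℝ, 0 < σ → 0 < γ →
          (∀ p : ℝ, IntegrableOn (invKernelE ((F : Lp ℂ 2 muHalf) : ℂ → ℂ) p) (rectE σ γ) volume) ∧
          MemLp (invTruncE σ γ ((F : Lp ℂ 2 muHalf) : ℂ → ℂ)) 2 volume) ∧
        Tendsto
          (fun s : ℝ × ℝ =>
            eLpNorm
              (fun p : ℝ => invTruncE s.1 s.2 ((F : Lp ℂ 2 muHalf) : ℂ → ℂ) p -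
                ((U.symm F : Lp ℂ 2 (volume : Measure ℝ)) : ℝ → ℂ) p) 2 volume)
          (atTop ×ˢ atTop) (𝓝 0))) ∧
    -- inversion on the image of the even Schwartz functions, the limit being pointwise
    (∀ ψ : evenSchwartz, ∀ p : ℝ, p ≠ 0 →
      Tendsto (fun s : ℝ × ℝ => invTruncE s.1 s.2 (transformE (ψ : 𝓢(ℝ, ℂ))) p)
        (atTop ×ˢ atTop) (𝓝 ((ψ : 𝓢(ℝ, ℂ)) p))) := by
  obtain ⟨U, hU⟩ := exists_unitary_transformE
  have hdiff : ∀ ψ : evenSchwartz, DifferentiableOn ℂ (transformE (ψ : 𝓢(ℝ, ℂ))) upperHalf := by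
    intro ψ
    rw [← transformE_evenSchwartzToL2]
    exact (hU _).1
  have hUS : ∀ ψ : evenSchwartz, (U (evenSchwartzToL2 ψ) : Lp ℂ 2 muHalf) =ᵐ[muHalf]
      transformE (ψ : 𝓢(ℝ, ℂ)) := by
    intro ψ
    rw [← transformE_evenSchwartzToL2]
    exact (hU _).2
  refine ⟨fun ψ => ⟨fun z hz => integrable_kernelE_of_memLp ((ψ : 𝓢(ℝ, ℂ)).memLp 2 volume) hz,
    hdiff ψ, (memLp_congr_ae (hUS ψ)).mp (Lp.memLp _)⟩, fun φ ψ => ?_, denseRange_evenSchwartzToL2,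
    ⟨U, hUS, fun F => ⟨fun σ γ _ hγ => ⟨fun p => integrableOn_invKernelE (Lp.memLp _) σ hγ p,
      memLp_invTruncE (Lp.memLp _) σ hγ⟩,
      tendsto_eLpNorm_invTruncE_sub (fun ψ => (hU ψ).2) F⟩⟩,
    fun ψ p hp => tendsto_invTruncE_pointwise (fun ψ => (hU ψ).2) (hdiff ψ) hp⟩
  -- `inner` is conjugate-linear in its first argument, so `ψ` comes first.
  have h : inner ℂ (U (evenSchwartzToL2 ψ) : Lp ℂ 2 muHalf) (U (evenSchwartzToL2 φ)) =
      inner ℂ (evenSchwartzToL2 ψ : Lp ℂ 2 (volume : Measure ℝ)) (evenSchwartzToL2 φ) :=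
    U.inner_map_map _ _
  rw [L2.inner_def, L2.inner_def] at h
  have h1 : ∫ z, transformE (φ : 𝓢(ℝ, ℂ)) z * conj (transformE (ψ : 𝓢(ℝ, ℂ)) z) ∂muHalf =
      ∫ z, inner ℂ ((U (evenSchwartzToL2 ψ) : Lp ℂ 2 muHalf) z)
        ((U (evenSchwartzToL2 φ) : Lp ℂ 2 muHalf) z) ∂muHalf := by
    apply integral_congr_ae
    filter_upwards [hUS φ, hUS ψ] with z h2 h3
    rw [h2, h3, RCLike.inner_apply]
  rw [h1, h]
  apply integral_congr_ae
  filter_upwards [(φ : 𝓢(ℝ, ℂ)).coeFn_toLp 2 volume, (ψ : 𝓢(ℝ, ℂ)).coeFn_toLp 2 volume]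
    with p h2 h3
  rw [← h2, ← h3]
  rfl
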